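/- Let $n\ge 1$. For $s>0$ and an arbitrary set $E\subset\mathbb R^n$ let $$\mathcal H^{s}_\infty(E)=\inf\Big\{\sum_i r_i^{s}:\ E\subset\bigcup_i B(x_i,r_i)\Big\}$$ be its $s$-dimensional Hausdorff content, the infimum being over all countable (or finite) families of open balls covering $E$. For an arbitrary function $g:\mathbb R^n\to[0,\infty]$ let $$\int_{\mathbb R^n} g\,d\mathcal H^{s}_\infty=\int_0^\infty \mathcal H^{s}_\infty\big(\{x\in\mathbb R^n: g(x)>t\}\big)\,dt$$ be its Choquet integral. For $0<\alpha<n$ and $f:\mathbb R^n\to[-\infty,\infty]$ put $$\mathcal R^n_\alpha f(x)=\int_{\mathbb R^n}\frac{|f(y)|}{|x-y|^{n-\alpha}}\,d\mathcal H^n_\infty(y),\qquad x\in\mathbb R^n .$$ (i) Let $\delta\in(0,n]$, $\alpha\in(0,\delta)$, $\kappa\in[0,\alpha)$ and $p\in(\delta/n,\delta/\alpha)$. Then there is a finite constant $c>0$, depending only on $n,\delta,\alpha,\kappa$ and $p$, such that for all Lebesgue measurable functions $f:\mathbb R^n\to[-\infty,\infty]$ $$\bigg(\int_{\mathbb R^n}\big(\mathcal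 R^n_\alpha f(x)\big)^{\frac{p(\delta-\kappa p)}{\delta-p\alpha}}\,d\mathcal H^{\delta-\kappa p}_\infty\bigg)^{\frac{\delta-p\alpha}{p(\delta-\kappa p)}}\le c\,\bigg(\int_{\mathbb R^n}|f(x)|^p\,d\mathcal H^\delta_\infty\bigg)^{\frac1p}.$$ (ii) The classical Hardy–Littlewood–Sobolev inequality (the case $\delta=n$, $\kappa=0$, with Lebesgue integrals in place of Choquet integrals) also holds: for $\alpha\in(0,n)$ and $p\in(1,n/\alpha)$ there is a finite constant $c>0$, depending only on $n,\alpha$ and $p$, such that for all Lebesgue measurable $f:\mathbb R^n\to[-\infty,\infty]$ $$\bigg(\int_{\mathbb R^n}\bigg(\int_{\mathbb R^n}\frac{|f(y)|}{|x-y|^{n-\alpha}}\,dy\bigg)^{\frac{np}{n-p\alpha}}dx\bigg)^{\frac{n-p\alpha}{np}}\le c\,\bigg(\int_{\mathbb R^n}|f(x)|^p\,dx\bigg)^{\frac1p}.$$ -/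

import Mathlib

open MeasureTheory Set
open scoped ENNReal NNReal

noncomputable section

/-- The `s`-dimensional Hausdorff content of `A ⊆ ℝⁿ` (used for `s > 0`): the infimum of `∑ rᵢ ^ s`
over all countable families of open balls `B(xᵢ, rᵢ)` that cover `A`. Radius `0` gives the empty
ball and contributes `0 ^ s = 0`, so that finite families are included. -/
def hausdorffContent {n : ℕ} (s : ℝ) (A : Set (EuclideanSpace ℝ (Fin n))) : ℝ≥0∞ :=
  ⨅ (x : ℕ → EuclideanSpace ℝ (Fin n)) (r : ℕ → ℝ≥0)
    (_ : A ⊆ ⋃ i, Metric.ball (x i) (r i)), ∑' i, (r i : ℝ≥0∞) ^ s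

/-- The Choquet integral `∫ g dH = ∫₀^∞ H {x | g x > t} dt` of an arbitrary function
`g : X → [0, ∞]` with respect to a set function `H`. -/
def choquetIntegral {X : Type*} (H : Set X → ℝ≥0∞) (g : X → ℝ≥0∞) : ℝ≥0∞ :=
  ∫⁻ t in Ioi (0 : ℝ), H {x | ENNReal.ofReal t < g x}

/-- The Hausdorff content Riesz potential
`x ↦ ∫ |f y| / |x - y| ^ (δ - α) dH^δ_∞(y)`, a Choquet integral over `ℝⁿ`. -/
def contentRieszPotential {n : ℕ} (δ α : ℝ) (f : EuclideanSpace ℝ (Fin n) → EReal)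
    (x : EuclideanSpace ℝ (Fin n)) : ℝ≥0∞ :=
  choquetIntegral (hausdorffContent δ) fun y => (f y).abs / ‖x - y‖ₑ ^ (δ - α)

end

/-!
The proof works on dyadic cubes. A cube is a pair `(k, m)`, the set where `dyadicCell k` equals `m`,
of side `2 ^ (-k)`; up to constants, Hausdorff contents can be computed with coverings by dyadic
cubes, and `H^n_∞` is comparable to Lebesgue outer measure, so that the content Riesz potential is
comparable to the ordinary one.

Write `σ = δ - κ p`, let `a_k(x)` be the average of `|f|` over the cube of side `2 ^ (-k)`
containing `x` and its neighbours, up to normalization (`nbhdMean`), and let `D` be the Choquet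
integral of `|f| ^ p` with respect to `H^δ_∞`. Two estimates carry the proof:

* `a_k(x) ^ p ≤ C 2 ^ (k δ) D`;
* the fractional maximal function bound: the Choquet integral with respect to `H^σ_∞` of
  `x ↦ sup_k 2 ^ (-k κ p) a_k(x) ^ p` is at most `C D`.

Given these, the argument of Hedberg applies: the Riesz potential is at most a constant times
`∑ 2 ^ (-k α) a_k(x)`, in which coarse scales are controlled by the first estimate and fine scales
by the maximal function; the best choice of the splitting scale gives a product of powers
(`exists_tsum_min_le`) that integrates to the claim (`exists_choquetIntegral_riesz_le`).

For `δ < n` the two estimates follow from a sublinearity property of the Choquet integral: the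
integral of `∑ w_Q 1_Q` is at most `C ∑ w_Q ℓ(Q) ^ σ` for any weights on dyadic cubes
(`exists_choquetIntegral_tsum_le`). Its proof is a layer cake argument: for every height `t`, the
cubes at which the weights, summed along the chain of larger cubes, first exceed `t` cover the
superlevel set, and every cube is selected for a set of heights of measure at most its weight. One
covers the superlevel sets of `|f| ^ p` by dyadic cubes (`exists_dyadic_majorant`) and, taking
powers with exponent `s = min p 1 > δ / n`, reduces to single cubes, for which the averages are explicit
and the resulting geometric series converges because `δ < n s`
(`exists_nbhdMean_bounds_of_lt`).

For `δ = n` one has `p > 1`, and `D` is comparable to the Lebesgue integral of `|f| ^ p`. The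
superlevel sets of the maximal function are covered by neighbours of maximal cubes, and a change of
variables in the level turns the sum of their contents into the sum of volumes that appears in
Doob's maximal inequality (`exists_choquetIntegral_iSup_nbhdMean_le`).

The classical inequality is the case `δ = n`, `κ = 0`.
-/

open MeasureTheory Set
open scoped ENNReal NNReal

/-! ### Powers of two and sums in the extended nonnegative reals -/

/-- The real power `2 ^ x` as an extended nonnegative real number. -/
noncomputable def twoPow (x : ℝ) : ℝ≥0∞ := (2 : ℝ≥0∞) ^ x

theorem twoPow_add (x y : ℝ) : twoPow (x + y) = twoPow x * twoPow y :=
  ENNReal.rpow_add x y two_ne_zero (by simp)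

theorem twoPow_rpow (x y : ℝ) : twoPow x ^ y = twoPow (x * y) :=
  (ENNReal.rpow_mul 2 x y).symm

@[simp] theorem twoPow_ne_top (x : ℝ) : twoPow x ≠ ∞ :=
  ENNReal.rpow_ne_top_of_ne_zero two_ne_zero (by simp)

@[simp] theorem twoPow_ne_zero (x : ℝ) : twoPow x ≠ 0 := by
  simp [twoPow, ENNReal.rpow_eq_zero_iff]

@[simp] theorem twoPow_zero : twoPow 0 = 1 := by simp [twoPow]

theorem twoPow_mono {x y : ℝ} (h : x ≤ y) : twoPow x ≤ twoPow y :=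
  ENNReal.rpow_le_rpow_of_exponent_le (by norm_num) h

theorem twoPow_mul_neg (x : ℝ) : twoPow x * twoPow (-x) = 1 := by
  rw [← twoPow_add]; simp

theorem twoPow_neg_mul (x : ℝ) : twoPow (-x) * twoPow x = 1 := by
  rw [← twoPow_add]; simp

theorem twoPow_one_le {x : ℝ} (h : 0 ≤ x) : 1 ≤ twoPow x := by
  simpa using twoPow_mono h

theorem twoPow_eq_ofReal (x : ℝ) : twoPow x = ENNReal.ofReal ((2 : ℝ) ^ x) := by
  rw [← ENNReal.ofReal_rpow_of_pos (by norm_num)]; simp [twoPow]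

theorem twoPow_mul_int_eq_ofReal (k : ℤ) : twoPow k = ENNReal.ofReal ((2 : ℝ) ^ k) := by
  rw [twoPow_eq_ofReal, Real.rpow_intCast]

/-- The sum `∑ i, 2 ^ (-i ε)` of a geometric series. -/
noncomputable def geomSum (ε : ℝ) : ℝ≥0∞ := ∑' i : ℕ, twoPow (-(i * ε))

theorem geomSum_ne_top {ε : ℝ} (hε : 0 < ε) : geomSum ε ≠ ∞ := by
  have h : ∀ i : ℕ, twoPow (-(i * ε)) = twoPow (-ε) ^ i := fun i => by
    rw [← ENNReal.rpow_natCast, twoPow_rpow]; ring_nf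
  have h1 : twoPow (-ε) < 1 := by
    refine ENNReal.rpow_lt_one_of_one_lt_of_neg (by norm_num) (by linarith)
  simp only [geomSum, h, ENNReal.tsum_geometric]
  exact ENNReal.inv_ne_top.2 (tsub_pos_of_lt h1).ne'

theorem tsum_int_le_eq_geomSum (ε : ℝ) (j : ℤ) :
    ∑' k : ℤ, (if k ≤ j then twoPow ((k - j) * ε) else 0) = geomSum ε := by
  have hinj : Function.Injective (fun i : ℕ => j - (i : ℤ)) := fun a b h => by
    simpa using h
  rw [geomSum, ← hinj.tsum_eq]
  · refine tsum_congr fun i => ?_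
    rw [if_pos (by simp)]
    congr 1; push_cast; ring
  · intro k hk
    by_cases h : k ≤ j
    · exact ⟨(j - k).toNat, by simp [Int.toNat_of_nonneg (sub_nonneg.2 h)]⟩
    · simp [h] at hk

theorem tsum_int_ge_eq_geomSum (ε : ℝ) (j : ℤ) :
    ∑' k : ℤ, (if j ≤ k then twoPow ((j - k) * ε) else 0) = geomSum ε := by
  rw [← tsum_int_le_eq_geomSum ε (-j), ← (Equiv.neg ℤ).tsum_eq]
  refine tsum_congr fun k => ?_
  simp only [Equiv.neg_apply]
  congr 1
  · simp only [eq_iff_iff]; constructor <;> intro h <;> linarith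
  · push_cast; ring_nf

/-- For exponents at most one, powers are subadditive, also for infinite sums. -/
theorem rpow_tsum_le_tsum_rpow {ι : Type*} (f : ι → ℝ≥0∞) {s : ℝ} (hs0 : 0 < s) (hs : s ≤ 1) :
    (∑' i, f i) ^ s ≤ ∑' i, f i ^ s := by
  have hfin : ∀ t : Finset ι, (∑ i ∈ t, f i) ^ s ≤ ∑' i, f i ^ s := fun t =>
    (Finset.le_sum_of_subadditive (fun x : ℝ≥0∞ => x ^ s) (by simp [hs0])
      (fun x y => ENNReal.rpow_add_le_add_rpow x y hs0.le hs) t f).trans (ENNReal.sum_le_tsum t)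
  have : (∑' i, f i) ≤ (∑' i, f i ^ s) ^ s⁻¹ := by
    rw [ENNReal.tsum_eq_iSup_sum]
    exact iSup_le fun t => (ENNReal.le_rpow_inv_iff hs0).2 (hfin t)
  exact (ENNReal.le_rpow_inv_iff hs0).1 this

/-- Jensen's inequality on a set, for integrals that are not normalized. -/
theorem rpow_setLIntegral_le {X : Type*} [MeasurableSpace X] {μ : Measure X} {F : X → ℝ≥0∞}
    (hF : AEMeasurable F μ) (T : Set X) {r : ℝ} (hr : 1 ≤ r) :
    (∫⁻ x in T, F x ∂μ) ^ r ≤ μ T ^ (r - 1) * ∫⁻ x in T, F x ^ r ∂μ := by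
  rcases hr.eq_or_lt with rfl | hr
  · simp
  have hc := Real.HolderConjugate.conjExponent hr
  have h := ENNReal.lintegral_mul_le_Lp_mul_Lq (μ.restrict T) hc hF.restrict
    (aemeasurable_const (b := (1 : ℝ≥0∞)))
  simp only [Pi.mul_apply, mul_one, ENNReal.one_rpow, lintegral_const, Measure.restrict_apply,
    MeasurableSet.univ, univ_inter, one_mul] at h
  have hr0 : 0 < r := by linarith
  refine (ENNReal.rpow_le_rpow h hr0.le).trans_eq ?_
  rw [ENNReal.mul_rpow_of_nonneg _ _ hr0.le, ← ENNReal.rpow_mul, ← ENNReal.rpow_mul,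
    one_div_mul_cancel hr0.ne', ENNReal.rpow_one, mul_comm]
  congr 2
  rw [Real.conjExponent]; field_simp

/-- The substitution `t = c τ ^ p` on the half line. -/
theorem lintegral_Ioi_rpow_subst (φ : ℝ → ℝ≥0∞) {c p : ℝ} (hc : 0 < c) (hp : 0 < p) :
    ∫⁻ t in Ioi (0 : ℝ), φ t =
      ∫⁻ τ in Ioi (0 : ℝ), ENNReal.ofReal (c * (p * τ ^ (p - 1))) * φ (c * τ ^ p) := by
  have himg : (fun τ : ℝ => c * τ ^ p) '' Ioi 0 = Ioi 0 := by
    ext t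
    constructor
    · rintro ⟨τ, hτ, rfl⟩
      exact mul_pos hc (Real.rpow_pos_of_pos hτ p)
    · intro ht
      have ht' : 0 < t / c := div_pos ht hc
      refine ⟨(t / c) ^ p⁻¹, Real.rpow_pos_of_pos ht' _, ?_⟩
      simp only
      rw [Real.rpow_inv_rpow ht'.le hp.ne']
      field_simp
  conv_lhs => rw [← himg]
  rw [lintegral_image_eq_lintegral_abs_deriv_mul (f' := fun τ => c * (p * τ ^ (p - 1)))
    measurableSet_Ioi]
  · refine setLIntegral_congr_fun measurableSet_Ioi fun τ hτ => ?_
    rw [abs_of_nonneg]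
    have := Real.rpow_pos_of_pos hτ (p - 1)
    positivity
  · intro τ hτ
    exact ((Real.hasDerivAt_rpow_const (Or.inl (ne_of_gt hτ))).const_mul c).hasDerivWithinAt
  · intro a ha b hb hab
    have := mul_left_cancel₀ hc.ne' hab
    exact (Real.rpow_left_injOn hp.ne') (mem_Ioi.1 ha).le (mem_Ioi.1 hb).le this

/-! ### Choquet integrals -/

theorem choquetIntegral_mono {X : Type*} {H : Set X → ℝ≥0∞} (hH : Monotone H) {g g' : X → ℝ≥0∞}
    (h : ∀ x, g x ≤ g' x) : choquetIntegral H g ≤ choquetIntegral H g' :=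
  lintegral_mono fun _ => hH fun x hx => lt_of_lt_of_le hx (h x)

theorem choquetIntegral_mono_content {X : Type*} {H H' : Set X → ℝ≥0∞} {C : ℝ≥0∞} (hC : C ≠ ∞)
    (h : ∀ A, H A ≤ C * H' A) (g : X → ℝ≥0∞) :
    choquetIntegral H g ≤ C * choquetIntegral H' g := by
  rw [choquetIntegral, choquetIntegral, ← lintegral_const_mul' _ _ hC]
  exact lintegral_mono fun _ => h _

/-- Choquet integrals are positively homogeneous. -/
theorem choquetIntegral_const_mul {X : Type*} {H : Set X → ℝ≥0∞} {c : ℝ≥0∞} (h0 : c ≠ 0)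
    (ht : c ≠ ∞) (g : X → ℝ≥0∞) :
    choquetIntegral H (fun x => c * g x) = c * choquetIntegral H g := by
  have hc : 0 < c.toReal := ENNReal.toReal_pos h0 ht
  rw [choquetIntegral, lintegral_Ioi_rpow_subst _ hc one_pos, choquetIntegral,
    ← lintegral_const_mul' _ _ ht]
  refine setLIntegral_congr_fun measurableSet_Ioi fun τ hτ => ?_
  simp only [sub_self, Real.rpow_zero, mul_one, Real.rpow_one, ENNReal.ofReal_toReal ht]
  congr 2
  ext x
  simp only [mem_ofPred_eq]
  rw [ENNReal.ofReal_mul hc.le, ENNReal.ofReal_toReal ht, ENNReal.mul_lt_mul_iff_right h0 ht]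

theorem volume_setOf_ofReal_lt (a : ℝ≥0∞) :
    volume {t : ℝ | 0 < t ∧ ENNReal.ofReal t < a} = a := by
  induction a with
  | top =>
    have : {t : ℝ | 0 < t ∧ ENNReal.ofReal t < ∞} = Ioi 0 := by ext t; simp
    rw [this, Real.volume_Ioi]
  | coe a =>
    have : {t : ℝ | 0 < t ∧ ENNReal.ofReal t < a} = Ioo 0 (a : ℝ) := by
      ext t
      simp only [mem_ofPred_eq, mem_Ioo, and_congr_right_iff]
      intro ht
      rw [← ENNReal.ofReal_coe_nnreal, ENNReal.ofReal_lt_ofReal_iff_of_nonneg ht.le]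
    rw [this]; simp

/-- The layer cake formula: for a measure, the Choquet integral is the Lebesgue integral. -/
theorem choquetIntegral_measure {X : Type*} [MeasurableSpace X] (μ : Measure X) [SFinite μ]
    {g : X → ℝ≥0∞} (hg : AEMeasurable g μ) :
    choquetIntegral (fun A => μ A) g = ∫⁻ x, g x ∂μ := by
  wlog hm : Measurable g generalizing g
  · rw [lintegral_congr_ae hg.ae_eq_mk, ← this hg.measurable_mk.aemeasurable hg.measurable_mk]
    refine lintegral_congr fun t => measure_congr ?_
    filter_upwards [hg.ae_eq_mk] with x hx
    simp only [eq_iff_iff]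
    change _ < _ ↔ _ < _
    rw [hx]
  have hms : MeasurableSet {z : ℝ × X | ENNReal.ofReal z.1 < g z.2} :=
    measurableSet_lt (ENNReal.measurable_ofReal.comp measurable_fst) (hm.comp measurable_snd)
  have h1 : ∀ t : ℝ, μ {x | ENNReal.ofReal t < g x} =
      ∫⁻ x, {z : ℝ × X | ENNReal.ofReal z.1 < g z.2}.indicator 1 (t, x) ∂μ := fun t => by
    rw [← lintegral_indicator_one (measurableSet_lt measurable_const hm)]
    rfl
  have h2 : ∀ x, ∫⁻ t in Ioi (0 : ℝ), {z : ℝ × X | ENNReal.ofReal z.1 < g z.2}.indicator 1 (t, x)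
      = g x := fun x => by
    have hmx : MeasurableSet {t : ℝ | ENNReal.ofReal t < g x} :=
      measurableSet_lt ENNReal.measurable_ofReal measurable_const
    have : (fun t : ℝ =>
        {z : ℝ × X | ENNReal.ofReal z.1 < g z.2}.indicator (1 : ℝ × X → ℝ≥0∞) (t, x))
        = {t : ℝ | ENNReal.ofReal t < g x}.indicator 1 := rfl
    rw [this, lintegral_indicator_one hmx, Measure.restrict_apply hmx]
    conv_rhs => rw [← volume_setOf_ofReal_lt (g x)]
    congr 1; ext t; simp [and_comm]
  rw [choquetIntegral]
  simp_rw [h1]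
  rw [lintegral_lintegral_swap]
  · exact lintegral_congr h2
  · exact (measurable_const.indicator hms).aemeasurable

/-- For an arbitrary function the lower Lebesgue integral is at most the Choquet integral. -/
theorem lintegral_le_choquetIntegral {X : Type*} [MeasurableSpace X] (μ : Measure X) [SFinite μ]
    (g : X → ℝ≥0∞) : ∫⁻ x, g x ∂μ ≤ choquetIntegral (fun A => μ A) g := by
  obtain ⟨g', hm, hle, heq⟩ := exists_measurable_le_lintegral_eq μ g
  rw [heq, ← choquetIntegral_measure μ hm.aemeasurable]
  exact choquetIntegral_mono (fun _ _ h => measure_mono h) hle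

/-! ### Hausdorff content and Lebesgue measure -/

theorem hausdorffContent_mono {n : ℕ} (s : ℝ) :
    Monotone (hausdorffContent s : Set (EuclideanSpace ℝ (Fin n)) → ℝ≥0∞) := fun _ _ h =>
  le_iInf fun x => le_iInf fun r => le_iInf fun hB =>
    (iInf_le _ x).trans <| (iInf_le _ r).trans <| iInf_le _ (h.trans hB)

theorem hausdorffContent_le_tsum {n : ℕ} {s : ℝ} (hs : 0 < s) {ι : Type*} [Countable ι]
    {A : Set (EuclideanSpace ℝ (Fin n))} (x : ι → EuclideanSpace ℝ (Fin n)) (r : ι → ℝ≥0)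
    (hA : A ⊆ ⋃ i, Metric.ball (x i) (r i)) :
    hausdorffContent s A ≤ ∑' i, (r i : ℝ≥0∞) ^ s := by
  obtain ⟨e, he⟩ := exists_injective_nat ι
  have hcov : A ⊆ ⋃ j, Metric.ball (Function.extend e x 0 j) (Function.extend e r 0 j : ℝ≥0) := by
    refine hA.trans (iUnion_subset fun i => ?_)
    refine subset_iUnion_of_subset (e i) ?_
    rw [he.extend_apply, he.extend_apply]
  refine (iInf_le _ _).trans ((iInf_le _ _).trans ((iInf_le _ hcov).trans_eq ?_))
  rw [← he.tsum_eq]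
  · simp [he.extend_apply]
  · intro j hj
    by_contra hne
    have : Function.extend e r 0 j = 0 := Function.extend_apply' _ _ _ (by simpa using hne)
    simp [this, hs] at hj

theorem exists_cover_of_hausdorffContent_lt {n : ℕ} {s : ℝ} {A : Set (EuclideanSpace ℝ (Fin n))}
    {D : ℝ≥0∞} (h : hausdorffContent s A < D) :
    ∃ (x : ℕ → EuclideanSpace ℝ (Fin n)) (r : ℕ → ℝ≥0),
      A ⊆ (⋃ i, Metric.ball (x i) (r i)) ∧ ∑' i, (r i : ℝ≥0∞) ^ s < D := by
  simpa only [hausdorffContent, iInf_lt_iff, exists_prop] using h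

theorem exists_volume_le_mul_hausdorffContent {n : ℕ} (hn : 1 ≤ n) :
    ∃ C : ℝ≥0∞, C ≠ ∞ ∧ ∀ A : Set (EuclideanSpace ℝ (Fin n)),
      volume A ≤ C * hausdorffContent n A := by
  refine ⟨volume (Metric.ball (0 : EuclideanSpace ℝ (Fin n)) 1), measure_ball_lt_top.ne,
    fun A => ?_⟩
  by_cases hA : hausdorffContent n A = ∞
  · rw [hA, ENNReal.mul_top (Metric.measure_ball_pos _ _ one_pos).ne']
    exact le_top
  refine le_of_forall_gt fun b hb => ?_
  have hv0 := (Metric.measure_ball_pos volume (0 : EuclideanSpace ℝ (Fin n)) one_pos).ne'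
  have hvt := (measure_ball_lt_top (μ := volume) (x := (0 : EuclideanSpace ℝ (Fin n)))
    (r := 1)).ne
  have hlt : hausdorffContent n A < b / volume (Metric.ball (0 : EuclideanSpace ℝ (Fin n)) 1) :=
    (ENNReal.lt_div_iff_mul_lt (Or.inl hv0) (Or.inl hvt)).2 (by rwa [mul_comm])
  obtain ⟨x, r, hcov, hsum⟩ := exists_cover_of_hausdorffContent_lt hlt
  calc volume A ≤ ∑' i, volume (Metric.ball (x i) (r i)) :=
        (measure_mono hcov).trans (measure_iUnion_le _)
    _ = (∑' i, (r i : ℝ≥0∞) ^ (n : ℝ)) *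
          volume (Metric.ball (0 : EuclideanSpace ℝ (Fin n)) 1) := by
        rw [← ENNReal.tsum_mul_right]
        refine tsum_congr fun i => ?_
        rcases eq_or_ne (r i) 0 with hr | hr
        · simp [hr, Nat.pos_iff_ne_zero.1 hn]
        · rw [Measure.addHaar_ball_of_pos _ _ (NNReal.coe_pos.2 (pos_iff_ne_zero.2 hr))]
          congr 1
          simp only [finrank_euclideanSpace, Fintype.card_fin, ENNReal.rpow_natCast]
          rw [ENNReal.ofReal_pow NNReal.zero_le_coe, ENNReal.ofReal_coe_nnreal]
    _ < b := (ENNReal.lt_div_iff_mul_lt (Or.inl hv0) (Or.inl hvt)).1 hsum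

/-- Hausdorff content in the top dimension is controlled by Lebesgue outer measure, by a Besicovitch
covering of almost minimal total volume. -/
theorem exists_hausdorffContent_le_mul_volume {n : ℕ} (hn : 1 ≤ n) :
    ∃ C : ℝ≥0∞, C ≠ ∞ ∧ ∀ A : Set (EuclideanSpace ℝ (Fin n)),
      hausdorffContent n A ≤ C * volume A := by
  have hv0 := (Metric.measure_ball_pos volume (0 : EuclideanSpace ℝ (Fin n)) one_pos).ne'
  set v := volume (Metric.ball (0 : EuclideanSpace ℝ (Fin n)) 1) with hv
  have hvt : v ≠ ∞ := measure_ball_lt_top.ne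
  refine ⟨2 ^ (n : ℝ) * v⁻¹, ENNReal.mul_ne_top (by simp) (ENNReal.inv_ne_top.2 hv0),
    fun A => ?_⟩
  have key : ∀ ε : ℝ≥0∞, ε ≠ 0 → hausdorffContent n A ≤ 2 ^ (n : ℝ) * v⁻¹ * (volume A + ε) := by
    intro ε hε
    obtain ⟨t, r, ht, -, hr, hcov, hsum⟩ :=
      Besicovitch.exists_closedBall_covering_tsum_measure_le
        (volume : Measure (EuclideanSpace ℝ (Fin n))) hε (fun _ => Ioi 0) A
        (fun x _ δ hδ => ⟨δ / 2, by simp [half_pos hδ, hδ]⟩)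
    have : Countable t := ht
    refine (hausdorffContent_le_tsum (by exact_mod_cast hn) (fun i : t => (i : _))
      (fun i : t => (2 * r i).toNNReal) (hcov.trans ?_)).trans ?_
    · refine iUnion₂_subset fun i hi => subset_iUnion_of_subset ⟨i, hi⟩ ?_
      have := hr i hi
      simp only [mem_Ioi] at this
      refine Metric.closedBall_subset_ball ?_
      rw [Real.coe_toNNReal _ (by linarith)]; linarith
    · refine le_trans (le_of_eq ?_) (mul_le_mul_right hsum _)
      rw [← ENNReal.tsum_mul_left]
      refine tsum_congr fun i => ?_
      have hri : 0 < r i := hr i i.2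
      rw [Measure.addHaar_closedBall _ _ hri.le, ← hv, mul_comm (ENNReal.ofReal _), ← mul_assoc,
        mul_assoc (2 ^ (n : ℝ)), ENNReal.inv_mul_cancel hv0 hvt, mul_one]
      simp only [finrank_euclideanSpace, Fintype.card_fin, ENNReal.rpow_natCast]
      rw [← ENNReal.ofReal, ENNReal.ofReal_mul (by norm_num), mul_pow, ENNReal.ofReal_pow hri.le]
      simp
  refine ENNReal.le_of_forall_pos_le_add fun ε hε _ => ?_
  have hK0 : 2 ^ (n : ℝ) * v⁻¹ ≠ 0 := mul_ne_zero (by simp) (ENNReal.inv_ne_zero.2 hvt)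
  have hKt : 2 ^ (n : ℝ) * v⁻¹ ≠ ∞ := ENNReal.mul_ne_top (by simp) (ENNReal.inv_ne_top.2 hv0)
  have := key (ε / (2 ^ (n : ℝ) * v⁻¹)) (ENNReal.div_ne_zero.2 ⟨by simp [hε.ne'], hKt⟩)
  rwa [mul_add, ENNReal.mul_div_cancel hK0 hKt] at this

/-! ### Dyadic cubes -/

/-- The index of the dyadic cube of side `2 ^ (-k)` that contains `x`. A dyadic cube of side
`2 ^ (-k)` is identified with the pair of `k` and the common value of `dyadicCell k` on it. -/
noncomputable def dyadicCell {n : ℕ} (k : ℤ) (x : EuclideanSpace ℝ (Fin n)) : Fin n → ℤ :=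
  fun i => ⌊(2 : ℝ) ^ k * x i⌋

/-- The lower corner of the dyadic cube with index `m` and side `2 ^ (-k)`. -/
noncomputable def dyadicCorner {n : ℕ} (k : ℤ) (m : Fin n → ℤ) : EuclideanSpace ℝ (Fin n) :=
  WithLp.toLp 2 fun i => (2 : ℝ) ^ (-k) * m i

/-- Two dyadic cubes of the same side are adjacent if their closures meet; a cube is adjacent to
itself. -/
def CellAdj {n : ℕ} (m m' : Fin n → ℤ) : Prop := ∀ i, m i ≤ m' i + 1 ∧ m' i ≤ m i + 1

/-- The union of the dyadic cubes adjacent to the cube of side `2 ^ (-k)` that contains `x`. -/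
def dyadicNbhd {n : ℕ} (k : ℤ) (x : EuclideanSpace ℝ (Fin n)) : Set (EuclideanSpace ℝ (Fin n)) :=
  {y | CellAdj (dyadicCell k x) (dyadicCell k y)}

variable {n : ℕ}

theorem CellAdj.symm {m m' : Fin n → ℤ} (h : CellAdj m m') : CellAdj m' m :=
  fun i => ⟨(h i).2, (h i).1⟩

theorem CellAdj.refl (m : Fin n → ℤ) : CellAdj m m := fun i => ⟨by omega, by omega⟩

@[simp] theorem dyadicCell_dyadicCorner (k : ℤ) (m : Fin n → ℤ) :
    dyadicCell k (dyadicCorner k m) = m := by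
  funext i
  simp only [dyadicCell, dyadicCorner]
  rw [← mul_assoc, ← zpow_add₀ two_ne_zero]
  simp

theorem dyadicCell_eq_div {k j : ℤ} (h : k ≤ j) (x : EuclideanSpace ℝ (Fin n)) (i : Fin n) :
    dyadicCell k x i = dyadicCell j x i / (2 : ℤ) ^ (j - k).toNat := by
  obtain ⟨d, rfl⟩ := Int.le.dest h
  simp only [dyadicCell, add_sub_cancel_left, Int.toNat_natCast]
  rw [← Int.mul_cast_floor_div_cancel_of_pos (n := 2 ^ d) (by positivity)]
  congr 2
  rw [zpow_add₀ two_ne_zero]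
  push_cast
  rw [zpow_natCast]
  ring

/-- Dyadic cubes are nested. -/
theorem dyadicCell_eq_of_le {k j : ℤ} (h : k ≤ j) {x y : EuclideanSpace ℝ (Fin n)}
    (hxy : dyadicCell j x = dyadicCell j y) : dyadicCell k x = dyadicCell k y := by
  funext i
  rw [dyadicCell_eq_div h, dyadicCell_eq_div h, hxy]

/-- The dyadic ancestors of adjacent cubes are adjacent. -/
theorem CellAdj.of_le {k j : ℤ} (h : k ≤ j) {x y : EuclideanSpace ℝ (Fin n)}
    (hxy : CellAdj (dyadicCell j x) (dyadicCell j y)) :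
    CellAdj (dyadicCell k x) (dyadicCell k y) := by
  have key : ∀ a b N : ℤ, 0 < N → a ≤ b + 1 → a / N ≤ b / N + 1 := fun a b N hN hab => by
    refine (Int.ediv_le_ediv hN (by nlinarith : a ≤ b + 1 * N)).trans_eq ?_
    rw [Int.add_mul_ediv_right _ _ hN.ne']
  intro i
  rw [dyadicCell_eq_div h, dyadicCell_eq_div h]
  exact ⟨key _ _ _ (by positivity) (hxy i).1, key _ _ _ (by positivity) (hxy i).2⟩

theorem cellAdj_of_dist_le {k : ℤ} {x y : EuclideanSpace ℝ (Fin n)}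
    (h : dist x y ≤ (2 : ℝ) ^ (-k)) : CellAdj (dyadicCell k x) (dyadicCell k y) := by
  have key : ∀ a b : ℝ, |a - b| ≤ (2 : ℝ) ^ (-k) →
      ⌊(2 : ℝ) ^ k * a⌋ ≤ ⌊(2 : ℝ) ^ k * b⌋ + 1 := fun a b hab => by
    rw [← Int.floor_add_one]
    refine Int.floor_le_floor ?_
    have h1 : (2 : ℝ) ^ k * (a - b) ≤ 2 ^ k * 2 ^ (-k) := by
      gcongr; exact (le_abs_self _).trans hab
    rw [← zpow_add₀ two_ne_zero] at h1
    simp at h1; linarith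
  intro i
  have hi : |x i - y i| ≤ (2 : ℝ) ^ (-k) := by
    refine le_trans ?_ h
    rw [dist_eq_norm, ← Real.norm_eq_abs]
    exact PiLp.norm_apply_le (x - y) i
  exact ⟨key _ _ hi, key _ _ (by rwa [abs_sub_comm])⟩

theorem dist_dyadicCorner_lt {k : ℤ} {x : EuclideanSpace ℝ (Fin n)} {m : Fin n → ℤ}
    (h : CellAdj (dyadicCell k x) m) :
    dist x (dyadicCorner k m) < (2 * n + 1) * (2 : ℝ) ^ (-k) := by
  have hk : (0 : ℝ) < 2 ^ (-k) := by positivity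
  have hi : ∀ i, ‖(x - dyadicCorner k m) i‖ ≤ 2 * (2 : ℝ) ^ (-k) := fun i => by
    have e : (x - dyadicCorner k m) i = (2 : ℝ) ^ (-k) * ((2 : ℝ) ^ k * x i - m i) := by
      rw [mul_sub, ← mul_assoc, ← zpow_add₀ two_ne_zero]
      simp [dyadicCorner]
    rw [e, norm_mul, Real.norm_of_nonneg hk.le, mul_comm]
    gcongr
    rw [Real.norm_eq_abs, abs_le]
    obtain ⟨h1, h2⟩ := h i
    simp only [dyadicCell] at h1 h2
    have h3 := Int.floor_le ((2 : ℝ) ^ k * x i)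
    have h4 := Int.lt_floor_add_one ((2 : ℝ) ^ k * x i)
    have h1' : (⌊(2 : ℝ) ^ k * x i⌋ : ℝ) ≤ m i + 1 := by exact_mod_cast h1
    have h2' : (m i : ℝ) ≤ ⌊(2 : ℝ) ^ k * x i⌋ + 1 := by exact_mod_cast h2
    constructor <;> linarith
  have hs : ‖x - dyadicCorner k m‖ ≤ ∑ i, ‖(x - dyadicCorner k m) i‖ := by
    rw [EuclideanSpace.norm_eq]
    refine Real.sqrt_le_iff.2 ⟨Finset.sum_nonneg fun _ _ => norm_nonneg _, ?_⟩
    exact Finset.sum_sq_le_sq_sum_of_nonneg fun _ _ => norm_nonneg _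
  rw [dist_eq_norm]
  calc _ ≤ ∑ i : Fin n, 2 * (2 : ℝ) ^ (-k) := hs.trans (Finset.sum_le_sum fun i _ => hi i)
    _ = 2 * n * (2 : ℝ) ^ (-k) := by simp; ring
    _ < _ := by linarith

theorem measurable_dyadicCell (k : ℤ) :
    Measurable (dyadicCell k : EuclideanSpace ℝ (Fin n) → Fin n → ℤ) :=
  measurable_pi_iff.2 fun i =>
    Int.measurable_floor.comp (((EuclideanSpace.proj i).continuous.measurable).const_mul _)

theorem measurableSet_dyadicCell_eq (k : ℤ) (m : Fin n → ℤ) :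
    MeasurableSet {x : EuclideanSpace ℝ (Fin n) | dyadicCell k x = m} :=
  measurable_dyadicCell k (measurableSet_singleton m)

theorem measurableSet_dyadicNbhd (k : ℤ) (x : EuclideanSpace ℝ (Fin n)) :
    MeasurableSet (dyadicNbhd k x) :=
  measurable_dyadicCell k (MeasurableSet.of_discrete (s := {m | CellAdj (dyadicCell k x) m}))

theorem volume_dyadicCell_eq (k : ℤ) (m : Fin n → ℤ) :
    volume {x : EuclideanSpace ℝ (Fin n) | dyadicCell k x = m} = twoPow (-(k * n)) := by
  have hk : (0 : ℝ) < 2 ^ k := by positivity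
  have hset : {x : EuclideanSpace ℝ (Fin n) | dyadicCell k x = m} =
      WithLp.ofLp ⁻¹' (Set.pi univ fun i => Ico ((2 : ℝ) ^ (-k) * m i)
        ((2 : ℝ) ^ (-k) * (m i + 1))) := by
    ext x
    simp only [mem_ofPred_eq, mem_preimage, mem_univ_pi, mem_Ico, dyadicCell, funext_iff,
      Int.floor_eq_iff]
    refine forall_congr' fun i => and_congr ?_ ?_
    · rw [zpow_neg, inv_mul_le_iff₀ hk]
    · rw [zpow_neg, lt_inv_mul_iff₀ hk]
  rw [hset, (PiLp.volume_preserving_ofLp (Fin n)).measure_preimage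
    (MeasurableSet.univ_pi fun _ => measurableSet_Ico).nullMeasurableSet, Real.volume_pi_Ico]
  have : ∀ i, ENNReal.ofReal ((2 : ℝ) ^ (-k) * (m i + 1) - (2 : ℝ) ^ (-k) * m i)
      = twoPow (-k) := fun i => by
    rw [← Int.cast_neg, twoPow_mul_int_eq_ofReal]; congr 1; ring
  simp only [this, Finset.prod_const, Finset.card_univ, Fintype.card_fin]
  rw [← ENNReal.rpow_natCast, twoPow_rpow]
  congr 1; ring

open Classical in
theorem tsum_cellAdj (m : Fin n → ℤ) (c : ℝ≥0∞) :
    ∑' m', (if CellAdj m m' then c else 0) = 3 ^ n * c := by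
  have h : ∀ m', CellAdj m m' ↔ m' ∈ Finset.Icc (m - 1) (m + 1) := fun m' => by
    simp only [CellAdj, Finset.mem_Icc, Pi.le_def, Pi.sub_apply, Pi.add_apply, Pi.one_apply,
      ← forall_and]
    exact forall_congr' fun i => ⟨fun h => ⟨by omega, by omega⟩, fun h => ⟨by omega, by omega⟩⟩
  simp only [h]
  rw [tsum_eq_sum (s := Finset.Icc (m - 1) (m + 1)) (fun m' hm' => if_neg hm'),
    Finset.sum_congr rfl (fun m' hm' => if_pos hm'), Finset.sum_const, Pi.card_Icc]
  have : ∀ i, (Finset.Icc ((m - 1) i) ((m + 1) i)).card = 3 := fun i => by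
    simp only [Pi.sub_apply, Pi.add_apply, Pi.one_apply, Int.card_Icc]; omega
  simp only [this, Finset.prod_const, Finset.card_univ, Fintype.card_fin, nsmul_eq_mul]
  norm_cast

open Classical in
/-- Decomposition of an integral according to the dyadic cubes of a fixed side. -/
theorem setLIntegral_dyadicCell_eq_tsum (k : ℤ) (T : (Fin n → ℤ) → Prop)
    (F : EuclideanSpace ℝ (Fin n) → ℝ≥0∞) :
    ∫⁻ y in {y | T (dyadicCell k y)}, F y =
      ∑' m, if T m then ∫⁻ y in {y | dyadicCell k y = m}, F y else 0 := by
  have hset : {y : EuclideanSpace ℝ (Fin n) | T (dyadicCell k y)} =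
      ⋃ m, {y | dyadicCell k y = m} ∩ {_y | T m} := by
    ext y; simp
  rw [hset, lintegral_iUnion (fun m => (measurableSet_dyadicCell_eq k m).inter (.const _))]
  · refine tsum_congr fun m => ?_
    by_cases h : T m <;> simp [h]
  · intro a b hab
    refine disjoint_left.2 fun y hy hy' => hab (hy.1.symm.trans hy'.1)

theorem volume_dyadicNbhd_le (k : ℤ) (x : EuclideanSpace ℝ (Fin n)) :
    volume (dyadicNbhd k x) ≤ 3 ^ n * twoPow (-(k * n)) := by
  classical
  have h := setLIntegral_dyadicCell_eq_tsum k (CellAdj (dyadicCell k x)) (fun _ => 1)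
  simp only [lintegral_const, one_mul, Measure.restrict_apply_univ, volume_dyadicCell_eq,
    tsum_cellAdj] at h
  exact h.le

/-! ### Dyadic coverings and Hausdorff content -/

/-- A covering by dyadic cubes and their neighbours bounds the Hausdorff content from above. -/
theorem exists_hausdorffContent_le_tsum_dyadic (n : ℕ) {σ : ℝ} (hσ : 0 < σ) :
    ∃ C : ℝ≥0∞, C ≠ ∞ ∧ ∀ (S : Set (ℤ × (Fin n → ℤ))) (E : Set (EuclideanSpace ℝ (Fin n))),
      (∀ x ∈ E, ∃ q ∈ S, CellAdj (dyadicCell q.1 x) q.2) →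
      hausdorffContent σ E ≤ C * ∑' q, S.indicator (fun q => twoPow (-(q.1 * σ))) q := by
  refine ⟨(2 * n + 1 : ℝ≥0∞) ^ σ, ENNReal.rpow_ne_top_of_nonneg hσ.le (by finiteness),
    fun S E h => ?_⟩
  refine (hausdorffContent_le_tsum hσ (fun q : S => dyadicCorner q.1.1 q.1.2)
    (fun q : S => (2 * n + 1) * (2 : ℝ≥0) ^ (-q.1.1)) ?_).trans_eq ?_
  · intro x hx
    obtain ⟨q, hq, hadj⟩ := h x hx
    exact mem_iUnion.2 ⟨⟨q, hq⟩, by simpa using dist_dyadicCorner_lt hadj⟩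
  · rw [← tsum_subtype S, ← ENNReal.tsum_mul_left]
    refine tsum_congr fun q => ?_
    push_cast
    rw [ENNReal.mul_rpow_of_nonneg _ _ hσ.le]
    congr 1
    rw [ENNReal.coe_zpow two_ne_zero, ← ENNReal.rpow_intCast]
    change twoPow _ ^ σ = _
    rw [twoPow_rpow]
    congr 1; push_cast; ring

/-- Almost optimal coverings can be chosen dyadic, up to a constant: a ball of radius comparable to
`2 ^ (-k)` is covered by the neighbours of the dyadic cube of side `2 ^ (-k)` that contains its
centre. -/
theorem exists_dyadic_cover_of_hausdorffContent_lt (n : ℕ) {δ : ℝ} (hδ : 0 < δ) :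
    ∃ C : ℝ≥0∞, C ≠ ∞ ∧ ∀ (E : Set (EuclideanSpace ℝ (Fin n))) (D : ℝ≥0∞),
      hausdorffContent δ E < D → ∃ S : Set (ℤ × (Fin n → ℤ)),
        (∀ x ∈ E, ∃ k, (k, dyadicCell k x) ∈ S) ∧
        ∑' q, S.indicator (fun q => twoPow (-(q.1 * δ))) q ≤ C * D := by
  classical
  refine ⟨3 ^ n * 2 ^ δ, by finiteness, fun E D hD => ?_⟩
  obtain ⟨z, r, hcov, hsum⟩ := exists_cover_of_hausdorffContent_lt hD
  -- balls of radius `0` are empty, and no scale is attached to them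
  have hk : ∀ i, ∃ k : ℤ, r i ≠ 0 → r i ≤ (2 : ℝ≥0) ^ (-k) ∧ (2 : ℝ≥0) ^ (-k) ≤ 2 * r i := by
    intro i
    by_cases hr : r i = 0
    · exact ⟨0, fun h => absurd hr h⟩
    obtain ⟨l, h1, h2⟩ := NNReal.exists_mem_Ico_zpow hr (y := 2) (by norm_num)
    refine ⟨-(l + 1), fun _ => ⟨by simpa using h2.le, ?_⟩⟩
    rw [neg_neg, zpow_add₀ two_ne_zero, zpow_one, mul_comm]
    gcongr
  choose k hk using hk
  refine ⟨{q | ∃ i, r i ≠ 0 ∧ q.1 = k i ∧ CellAdj (dyadicCell (k i) (z i)) q.2}, ?_, ?_⟩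
  · intro x hx
    obtain ⟨i, hi⟩ := mem_iUnion.1 (hcov hx)
    have hr : r i ≠ 0 := fun h => by simp [h] at hi
    refine ⟨k i, i, hr, rfl, cellAdj_of_dist_le ?_⟩
    rw [dist_comm]
    refine (Metric.mem_ball.1 hi).le.trans ?_
    exact_mod_cast (hk i hr).1
  · have h1 : ∀ q : ℤ × (Fin n → ℤ),
        {q : ℤ × (Fin n → ℤ) | ∃ i, r i ≠ 0 ∧ q.1 = k i ∧
          CellAdj (dyadicCell (k i) (z i)) q.2}.indicator (fun q => twoPow (-(q.1 * δ))) q ≤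
        ∑' i, if q.1 = k i then (if CellAdj (dyadicCell (k i) (z i)) q.2 then
          2 ^ δ * (r i : ℝ≥0∞) ^ δ else 0) else 0 := by
      intro q
      rw [indicator_apply]
      split_ifs with hmem
      swap
      · exact bot_le
      obtain ⟨i, hr, hq, hadj⟩ := hmem
      refine le_trans ?_ (ENNReal.le_tsum i)
      rw [if_pos hq, if_pos hadj, ← ENNReal.mul_rpow_of_nonneg _ _ hδ.le, hq, ← neg_mul,
        ← twoPow_rpow]
      refine ENNReal.rpow_le_rpow ?_ hδ.le
      rw [← Int.cast_neg, twoPow, ENNReal.rpow_intCast]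
      have := (hk i hr).2
      have h2 : ((2 : ℝ≥0) ^ (-k i) : ℝ≥0) ≤ ((2 * r i : ℝ≥0) : ℝ≥0∞) := by exact_mod_cast this
      rw [ENNReal.coe_zpow two_ne_zero] at h2
      simpa using h2
    calc _ ≤ ∑' q : ℤ × (Fin n → ℤ), ∑' i, _ := ENNReal.tsum_le_tsum h1
      _ = ∑' i, 3 ^ n * (2 ^ δ * (r i : ℝ≥0∞) ^ δ) := by
        rw [ENNReal.tsum_comm]
        refine tsum_congr fun i => ?_
        rw [ENNReal.tsum_prod']
        simp only
        rw [tsum_eq_single (k i) (fun l hl => by simp [hl])]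
        simp only [if_true]
        exact tsum_cellAdj _ _
      _ ≤ 3 ^ n * 2 ^ δ * D := by
        rw [ENNReal.tsum_mul_left, ENNReal.tsum_mul_left, mul_assoc]
        gcongr

/-! ### Sublinearity of the Choquet integral on sums over dyadic cubes -/

/-- The part of the sum `∑ j, W (j, dyadicCell j x)` with `j ≤ k`. -/
noncomputable def partialChainSum (W : ℤ × (Fin n → ℤ) → ℝ≥0∞) (k : ℤ)
    (x : EuclideanSpace ℝ (Fin n)) : ℝ≥0∞ :=
  ∑' j : ℤ, if j ≤ k then W (j, dyadicCell j x) else 0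

theorem partialChainSum_congr (W : ℤ × (Fin n → ℤ) → ℝ≥0∞) {k l : ℤ} (hl : l ≤ k)
    {x y : EuclideanSpace ℝ (Fin n)} (h : dyadicCell k x = dyadicCell k y) :
    partialChainSum W l x = partialChainSum W l y := by
  refine tsum_congr fun j => ?_
  split_ifs with hj
  · rw [dyadicCell_eq_of_le (hj.trans hl) h]
  · rfl

theorem partialChainSum_eq_add (W : ℤ × (Fin n → ℤ) → ℝ≥0∞) (k : ℤ)
    (x : EuclideanSpace ℝ (Fin n)) :
    partialChainSum W k x = partialChainSum W (k - 1) x + W (k, dyadicCell k x) := by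
  have h : W (k, dyadicCell k x) = ∑' j : ℤ, if j = k then W (j, dyadicCell j x) else 0 := by
    rw [tsum_ite_eq]
  rw [h, partialChainSum, partialChainSum, ← ENNReal.tsum_add]
  refine tsum_congr fun j => ?_
  rcases lt_trichotomy j k with h | h | h
  · simp [h.le, h.ne, Int.le_sub_one_iff.2 h]
  · simp [h]
  · have h1 : ¬ j ≤ k - 1 := by omega
    simp [h.not_ge, h.ne', h1]

theorem exists_lt_partialChainSum (W : ℤ × (Fin n → ℤ) → ℝ≥0∞) {x : EuclideanSpace ℝ (Fin n)}
    {t : ℝ≥0∞} (h : t < ∑' k, W (k, dyadicCell k x)) : ∃ k, t < partialChainSum W k x := by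
  rw [ENNReal.tsum_eq_iSup_sum, lt_iSup_iff] at h
  obtain ⟨s, hs⟩ := h
  obtain ⟨K, hK⟩ := s.bddAbove
  refine ⟨K, hs.trans_le ?_⟩
  refine le_trans (le_of_eq ?_) (ENNReal.sum_le_tsum s)
  exact Finset.sum_congr rfl fun j hj => (if_pos (hK hj)).symm

/-- The tails of the chain sums towards large cubes vanish. -/
theorem exists_partialChainSum_lt {W : ℤ × (Fin n → ℤ) → ℝ≥0∞} {x : EuclideanSpace ℝ (Fin n)}
    {t : ℝ≥0∞} (ht : 0 < t)
    (hW : ∑' k : ℤ, (if k ≤ 0 then W (k, dyadicCell k x) else 0) ≠ ∞) :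
    ∃ K, ∀ k ≤ K, partialChainSum W k x < t := by
  obtain ⟨s, hs⟩ := ((tendsto_order.1 (ENNReal.tendsto_tsum_compl_atTop_zero hW)).2 t ht).exists
  obtain ⟨K, hK⟩ := s.bddBelow
  refine ⟨min 0 (K - 1), fun k hk => lt_of_le_of_lt ?_ hs⟩
  rw [partialChainSum]
  have hsub := tsum_subtype {j : ℤ | j ∉ s} (fun j => if j ≤ 0 then W (j, dyadicCell j x) else 0)
  refine le_trans ?_ hsub.ge
  refine ENNReal.tsum_le_tsum fun j => ?_
  split_ifs with hj
  · have hjs : j ∉ s := fun hjs => by have := hK hjs; omega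
    rw [indicator_of_mem (by exact hjs), if_pos (by omega)]
  · exact bot_le

/-- The heights that lie between two consecutive chain sums, which differ by the weight `W`, form a
set of measure at most `W`. -/
theorem volume_setOf_ofReal_mem_le (P W : ℝ≥0∞) :
    volume {t : ℝ | 0 < t ∧ P ≤ ENNReal.ofReal t ∧ ENNReal.ofReal t < P + W} ≤ W := by
  rcases eq_or_ne P ∞ with rfl | hP
  · simp
  rcases eq_or_ne W ∞ with rfl | hW
  · exact le_top
  calc _ ≤ volume (Ico P.toReal (P.toReal + W.toReal)) := by
        refine measure_mono fun t ht => ?_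
        obtain ⟨h0, h1, h2⟩ := ht
        refine ⟨ENNReal.toReal_le_of_le_ofReal h0.le h1, ?_⟩
        rw [← ENNReal.toReal_add hP hW]
        exact (ENNReal.ofReal_lt_iff_lt_toReal h0.le (by finiteness)).1 h2
    _ = W := by rw [Real.volume_Ico, add_sub_cancel_left, ENNReal.ofReal_toReal hW]

/-- Bound for a Choquet integral whose superlevel sets are covered by dyadic cubes and their
neighbours, by integration of the coverings with respect to the level. -/
theorem exists_choquetIntegral_le_of_dyadic_cover (n : ℕ) {σ : ℝ} (hσ : 0 < σ) :
    ∃ C : ℝ≥0∞, C ≠ ∞ ∧ ∀ (g : EuclideanSpace ℝ (Fin n) → ℝ≥0∞)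
      (S : ℤ × (Fin n → ℤ) → Set ℝ), (∀ q, MeasurableSet (S q)) →
      (∀ t : ℝ, 0 < t → ∀ x, ENNReal.ofReal t < g x →
        ∃ q, t ∈ S q ∧ CellAdj (dyadicCell q.1 x) q.2) →
      choquetIntegral (hausdorffContent σ) g ≤
        C * ∑' q, twoPow (-(q.1 * σ)) * volume (Ioi 0 ∩ S q) := by
  obtain ⟨C, hC, h⟩ := exists_hausdorffContent_le_tsum_dyadic n hσ
  refine ⟨C, hC, fun g S hS hcov => ?_⟩
  have h1 : choquetIntegral (hausdorffContent σ) g ≤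
      ∫⁻ t in Ioi (0 : ℝ), C * ∑' q, (S q).indicator (fun _ => twoPow (-(q.1 * σ))) t := by
    refine setLIntegral_mono' measurableSet_Ioi fun t ht => ?_
    refine (h {q | t ∈ S q} _ fun x hx => ?_).trans_eq ?_
    · exact hcov t ht x hx
    · rfl
  refine h1.trans_eq ?_
  rw [lintegral_const_mul' _ _ hC,
    lintegral_tsum fun q => (measurable_const.indicator (hS q)).aemeasurable]
  congr 1
  refine tsum_congr fun q => ?_
  rw [lintegral_indicator_const (hS q), Measure.restrict_apply (hS q), inter_comm]

/-- The Choquet integral of a sum of multiples of indicator functions of dyadic cubes is at most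
a constant multiple of the corresponding sum of contents. The superlevel set at height `t` is
covered by those cubes at which the sum of the weights of the larger cubes in the chain first
exceeds `t`; integration in `t` counts every cube with its weight. -/
theorem exists_choquetIntegral_tsum_le (n : ℕ) {σ : ℝ} (hσ : 0 < σ) :
    ∃ C : ℝ≥0∞, C ≠ ∞ ∧ ∀ W : ℤ × (Fin n → ℤ) → ℝ≥0∞,
      choquetIntegral (hausdorffContent σ) (fun x => ∑' k, W (k, dyadicCell k x)) ≤
        C * ∑' q, W q * twoPow (-(q.1 * σ)) := by
  obtain ⟨C, hC, h⟩ := exists_choquetIntegral_le_of_dyadic_cover n hσ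
  -- the constant is made nonzero, so that only finite right-hand sides matter
  refine ⟨C + 1, by finiteness, fun W => ?_⟩
  by_cases hfin : ∑' q, W q * twoPow (-(q.1 * σ)) = ∞
  · rw [hfin, ENNReal.mul_top (by simp)]; exact le_top
  have htail : ∀ x : EuclideanSpace ℝ (Fin n),
      ∑' k : ℤ, (if k ≤ 0 then W (k, dyadicCell k x) else 0) ≠ ∞ := fun x => by
    refine ne_top_of_le_ne_top hfin ?_
    have hinj : Function.Injective fun k : ℤ => (k, dyadicCell k x) := fun a b hab =>
      congrArg Prod.fst hab
    refine le_trans (ENNReal.tsum_le_tsum fun k => ?_)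
      (ENNReal.tsum_comp_le_tsum_of_injective hinj fun q => W q * twoPow (-(q.1 * σ)))
    split_ifs with hk
    · refine le_mul_of_one_le_right' (twoPow_one_le ?_)
      have : (k : ℝ) ≤ 0 := by exact_mod_cast hk
      nlinarith
    · exact bot_le
  set S : ℤ × (Fin n → ℤ) → Set ℝ := fun q =>
    {t | partialChainSum W (q.1 - 1) (dyadicCorner q.1 q.2) ≤ ENNReal.ofReal t ∧
      ENNReal.ofReal t < partialChainSum W (q.1 - 1) (dyadicCorner q.1 q.2) + W q} with hS
  refine (h _ S (fun q => ?_) fun t ht x hx => ?_).trans ?_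
  · exact (measurableSet_le measurable_const ENNReal.measurable_ofReal).inter
      (measurableSet_lt ENNReal.measurable_ofReal measurable_const)
  · obtain ⟨K, hK⟩ := exists_partialChainSum_lt (ENNReal.ofReal_pos.2 ht) (htail x)
    obtain ⟨k, hk, hmin⟩ := Int.exists_least_of_bdd
      (P := fun k => ENNReal.ofReal t < partialChainSum W k x)
      ⟨K, fun k hk => le_of_not_ge fun hkK => absurd hk (hK k hkK).not_gt⟩
      (exists_lt_partialChainSum W hx)
    refine ⟨(k, dyadicCell k x), ?_, CellAdj.refl _⟩
    have hcorner : partialChainSum W (k - 1) (dyadicCorner k (dyadicCell k x)) =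
        partialChainSum W (k - 1) x := partialChainSum_congr W (k := k) (by omega) (by simp)
    simp only [hS, mem_ofPred_eq, hcorner, ← partialChainSum_eq_add]
    refine ⟨not_lt.1 fun hlt => ?_, hk⟩
    have := hmin _ hlt
    omega
  · refine mul_le_mul' le_self_add (ENNReal.tsum_le_tsum fun q => ?_)
    rw [mul_comm (W q)]
    exact mul_le_mul_right (volume_setOf_ofReal_mem_le _ _) _

/-! ### Dyadic majorants of arbitrary functions -/

/-- The Choquet integral dominates its lower Riemann sum over the dyadic heights `2 ^ i`. -/
theorem tsum_twoPow_mul_content_le {X : Type*} {H : Set X → ℝ≥0∞} (hH : Monotone H)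
    (h : X → ℝ≥0∞) :
    ∑' i : ℤ, twoPow (i - 1) * H {x | twoPow i < h x} ≤ choquetIntegral H h := by
  have hdisj : Pairwise (Function.onFun Disjoint fun i : ℤ => Ioc ((2 : ℝ) ^ (i - 1)) (2 ^ i)) := by
    intro i j hij
    wlog hlt : i < j generalizing i j
    · exact (this hij.symm (by omega)).symm
    refine disjoint_left.2 fun t ht ht' => absurd ht.2 (not_le.2 (lt_of_le_of_lt ?_ ht'.1))
    exact zpow_le_zpow_right₀ (by norm_num) (by omega)
  calc _ = ∑' i : ℤ, ∫⁻ _ in Ioc ((2 : ℝ) ^ (i - 1)) (2 ^ i), H {x | twoPow i < h x} := by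
        refine tsum_congr fun i => ?_
        rw [lintegral_const, Measure.restrict_apply_univ, Real.volume_Ioc, mul_comm]
        congr 1
        rw [← Int.cast_one, ← Int.cast_sub, twoPow_mul_int_eq_ofReal]
        congr 1
        rw [zpow_sub₀ two_ne_zero]; ring
    _ ≤ ∑' i : ℤ, ∫⁻ t in Ioc ((2 : ℝ) ^ (i - 1)) (2 ^ i), H {x | ENNReal.ofReal t < h x} := by
        refine ENNReal.tsum_le_tsum fun i => setLIntegral_mono' measurableSet_Ioc fun t ht => ?_
        have hle : ENNReal.ofReal t ≤ twoPow i := by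
          rw [twoPow_mul_int_eq_ofReal]
          exact ENNReal.ofReal_le_ofReal ht.2
        exact hH fun x (hx : twoPow i < h x) => hle.trans_lt hx
    _ = ∫⁻ t in ⋃ i : ℤ, Ioc ((2 : ℝ) ^ (i - 1)) (2 ^ i), H {x | ENNReal.ofReal t < h x} :=
        (lintegral_iUnion (fun i => measurableSet_Ioc) hdisj _).symm
    _ ≤ _ := by
        refine lintegral_mono_set (iUnion_subset fun i t ht => ?_)
        exact lt_trans (by positivity) ht.1

theorem le_of_forall_twoPow_lt {a b : ℝ≥0∞} (h : ∀ i : ℤ, twoPow i < a → twoPow (i + 1) ≤ b) :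
    a ≤ b := by
  have hcast : ∀ i : ℤ, twoPow i = (2 : ℝ≥0∞) ^ i := fun i => ENNReal.rpow_intCast 2 i
  by_contra! hlt
  have hb : b ≠ ∞ := hlt.ne_top
  rcases eq_or_ne b 0 with rfl | hb0
  · obtain ⟨i, hi⟩ : ∃ i : ℤ, twoPow i < a := by
      rcases eq_or_ne a ∞ with rfl | ha
      · exact ⟨0, by simp⟩
      · obtain ⟨i, hi, -⟩ := ENNReal.exists_mem_Ico_zpow hlt.ne' ha (y := 2) (by norm_num)
          (by simp)
        refine ⟨i - 1, lt_of_lt_of_le ?_ hi⟩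
        rw [← hcast, twoPow, twoPow]
        refine ENNReal.rpow_lt_rpow_of_exponent_lt (by norm_num) (by simp) ?_
        push_cast; linarith
    exact absurd (h i hi) (by simp)
  · obtain ⟨i, hi, hi'⟩ := ENNReal.exists_mem_Ico_zpow hb0 hb (y := 2) (by norm_num) (by simp)
    rw [← hcast] at hi hi'
    push_cast at hi'
    exact absurd (h i (hi.trans_lt hlt)) (not_le.2 hi')

/-- Every function has a majorant that is a sum over dyadic cubes and whose weights are controlled
by the Choquet integral: the superlevel sets at heights `2 ^ i` are covered almost optimally by
dyadic cubes, and the weight of a cube collects the heights whose coverings contain it. -/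
theorem exists_dyadic_majorant (n : ℕ) {δ s : ℝ} (hδ : 0 < δ) (hs0 : 0 < s) (hs : s ≤ 1) :
    ∃ C : ℝ≥0∞, C ≠ ∞ ∧ ∀ (h : EuclideanSpace ℝ (Fin n) → ℝ≥0∞) (η : ℝ≥0∞), η ≠ 0 →
      ∃ w : ℤ × (Fin n → ℤ) → ℝ≥0∞, (∀ x, h x ≤ (∑' k, w (k, dyadicCell k x)) ^ s) ∧
        ∑' q, w q ^ s * twoPow (-(q.1 * δ)) ≤
          C * (choquetIntegral (hausdorffContent δ) h + η) := by
  obtain ⟨C, hC, hcov⟩ := exists_dyadic_cover_of_hausdorffContent_lt n hδ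
  -- the constant is made nonzero, so that only finite Choquet integrals matter
  refine ⟨C * 4 + 1, by finiteness, fun h η hη => ?_⟩
  by_cases hfin : choquetIntegral (hausdorffContent δ) h = ∞
  · refine ⟨fun _ => ∞, fun x => ?_, ?_⟩
    · rw [ENNReal.tsum_const_eq_top_of_ne_zero (by simp), ENNReal.top_rpow_of_pos hs0]
      exact le_top
    · rw [hfin, top_add, ENNReal.mul_top (by simp)]; exact le_top
  have hlev := tsum_twoPow_mul_content_le (hausdorffContent_mono δ) h
  -- superlevel sets may have content `0`, so coverings are optimal up to small additive errors
  obtain ⟨ε, hε, hεsum⟩ := ENNReal.exists_pos_sum_of_countable' hη ℤ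
  have hHfin : ∀ i : ℤ, hausdorffContent δ {x | twoPow i < h x} ≠ ∞ := fun i hi => by
    have h1 := (ENNReal.le_tsum i).trans hlev
    rw [hi, ENNReal.mul_top (by simp)] at h1
    exact hfin (top_le_iff.1 h1)
  have hS : ∀ i : ℤ, ∃ S : Set (ℤ × (Fin n → ℤ)),
      (∀ x, twoPow i < h x → ∃ k, (k, dyadicCell k x) ∈ S) ∧
      ∑' q, S.indicator (fun q => twoPow (-(q.1 * δ))) q ≤
        C * (hausdorffContent δ {x | twoPow i < h x} + ε i * twoPow (-i)) := fun i =>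
    hcov _ _ (ENNReal.lt_add_right (hHfin i) (mul_ne_zero (hε i).ne' (by simp)))
  choose S hS1 hS2 using hS
  refine ⟨fun q => ∑' i : ℤ, (S i).indicator (fun _ => twoPow ((i + 1) * s⁻¹)) q, fun x => ?_, ?_⟩
  · refine le_of_forall_twoPow_lt fun i hi => ?_
    obtain ⟨k, hk⟩ := hS1 i x hi
    have h1 : twoPow (i + 1) = twoPow ((i + 1) * s⁻¹) ^ s := by
      rw [twoPow_rpow, inv_mul_cancel_right₀ hs0.ne']
    rw [h1]
    refine ENNReal.rpow_le_rpow ?_ hs0.le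
    refine le_trans ?_ (ENNReal.le_tsum k)
    refine le_trans ?_ (ENNReal.le_tsum i)
    rw [indicator_of_mem hk]
  · calc _ ≤ ∑' q : ℤ × (Fin n → ℤ), ∑' i : ℤ,
          twoPow (i + 1) * (S i).indicator (fun q => twoPow (-(q.1 * δ))) q := by
          refine ENNReal.tsum_le_tsum fun q => ?_
          refine (mul_le_mul_left (rpow_tsum_le_tsum_rpow _ hs0 hs) _).trans_eq ?_
          rw [← ENNReal.tsum_mul_right]
          refine tsum_congr fun i => ?_
          by_cases hq : q ∈ S i
          · rw [indicator_of_mem hq, indicator_of_mem hq, twoPow_rpow,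
              inv_mul_cancel_right₀ hs0.ne']
          · rw [indicator_of_notMem hq, indicator_of_notMem hq, ENNReal.zero_rpow_of_pos hs0,
              zero_mul, mul_zero]
      _ = ∑' i : ℤ, twoPow (i + 1) * ∑' q, (S i).indicator (fun q => twoPow (-(q.1 * δ))) q := by
          rw [ENNReal.tsum_comm]
          exact tsum_congr fun i => ENNReal.tsum_mul_left
      _ ≤ ∑' i : ℤ, C * 4 * (twoPow (i - 1) * hausdorffContent δ {x | twoPow i < h x} + ε i) := by
          refine ENNReal.tsum_le_tsum fun i => ?_
          refine (mul_le_mul_right (hS2 i) _).trans ?_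
          have h4 : twoPow (i + 1) = 4 * twoPow (i - 1) := by
            have : (4 : ℝ≥0∞) = twoPow 2 := by
              rw [twoPow, show (2 : ℝ) = ((2 : ℕ) : ℝ) by norm_num, ENNReal.rpow_natCast]
              norm_num
            rw [this, ← twoPow_add]; congr 1; ring
          calc _ = C * 4 * (twoPow (i - 1) * hausdorffContent δ {x | twoPow i < h x} +
                ε i * (twoPow (i - 1) * twoPow (-i))) := by rw [h4]; ring
            _ ≤ _ := by
              gcongr
              rw [← twoPow_add]
              refine mul_le_of_le_one_right' ?_
              simpa using twoPow_mono (show (i - 1 + -i : ℝ) ≤ 0 by linarith)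
      _ ≤ _ := by
          rw [ENNReal.tsum_mul_left, ENNReal.tsum_add]
          exact mul_le_mul' le_self_add (add_le_add hlev hεsum.le)

/-! ### Averages over dyadic neighbourhoods -/

/-- The integral of `F` over the dyadic neighbourhood of scale `k` of `x`, normalized by the volume
`2 ^ (-k n)` of one dyadic cube. -/
noncomputable def nbhdMean (k : ℤ) (F : EuclideanSpace ℝ (Fin n) → ℝ≥0∞)
    (x : EuclideanSpace ℝ (Fin n)) : ℝ≥0∞ :=
  twoPow (k * n) * ∫⁻ y in dyadicNbhd k x, F y

/-- The average of `F` over a dyadic cube. -/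
noncomputable def cellMean (F : EuclideanSpace ℝ (Fin n) → ℝ≥0∞) (q : ℤ × (Fin n → ℤ)) : ℝ≥0∞ :=
  twoPow (q.1 * n) * ∫⁻ y in {y | dyadicCell q.1 y = q.2}, F y

theorem rpow_mean_le {F : EuclideanSpace ℝ (Fin n) → ℝ≥0∞} (hF : AEMeasurable F volume)
    {r : ℝ} (hr : 1 ≤ r) (k : ℤ) (T : Set (EuclideanSpace ℝ (Fin n))) {c : ℝ≥0∞}
    (hT : volume T ≤ c * twoPow (-(k * n))) :
    (twoPow (k * n) * ∫⁻ y in T, F y) ^ r ≤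
      c ^ (r - 1) * (twoPow (k * n) * ∫⁻ y in T, F y ^ r) := by
  rw [ENNReal.mul_rpow_of_nonneg _ _ (by linarith), twoPow_rpow]
  calc _ ≤ twoPow (k * n * r) * ((c * twoPow (-(k * n))) ^ (r - 1) * ∫⁻ y in T, F y ^ r) := by
        gcongr
        refine (rpow_setLIntegral_le hF T hr).trans ?_
        gcongr
    _ = c ^ (r - 1) * ((twoPow (k * n * r) * twoPow (-(k * n) * (r - 1))) *
          ∫⁻ y in T, F y ^ r) := by
        rw [ENNReal.mul_rpow_of_nonneg _ _ (by linarith), twoPow_rpow]; ring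
    _ = _ := by rw [← twoPow_add]; ring_nf

theorem nbhdMean_rpow_le {F : EuclideanSpace ℝ (Fin n) → ℝ≥0∞} (hF : AEMeasurable F volume)
    {r : ℝ} (hr : 1 ≤ r) (k : ℤ) (x : EuclideanSpace ℝ (Fin n)) :
    nbhdMean k F x ^ r ≤ (3 ^ n) ^ (r - 1) * nbhdMean k (fun y => F y ^ r) x :=
  rpow_mean_le hF hr k _ (volume_dyadicNbhd_le k x)

theorem cellMean_rpow_le {F : EuclideanSpace ℝ (Fin n) → ℝ≥0∞} (hF : AEMeasurable F volume)
    {r : ℝ} (hr : 1 ≤ r) (q : ℤ × (Fin n → ℤ)) :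
    cellMean F q ^ r ≤ twoPow (q.1 * n) * ∫⁻ y, F y ^ r := by
  refine (rpow_mean_le hF hr q.1 _ (c := 1) ?_).trans ?_
  · rw [volume_dyadicCell_eq, one_mul]
  · rw [ENNReal.one_rpow, one_mul]
    gcongr
    exact Measure.restrict_le_self

theorem nbhdMean_congr_ae {F G : EuclideanSpace ℝ (Fin n) → ℝ≥0∞} (h : F =ᵐ[volume] G) (k : ℤ)
    (x : EuclideanSpace ℝ (Fin n)) : nbhdMean k F x = nbhdMean k G x := by
  rw [nbhdMean, nbhdMean, lintegral_congr_ae (ae_restrict_of_ae h)]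

/-- Among the cubes adjacent to that of `x`, one carries a fixed proportion of the mean. -/
theorem exists_nbhdMean_le_cellMean (F : EuclideanSpace ℝ (Fin n) → ℝ≥0∞) (k : ℤ)
    (x : EuclideanSpace ℝ (Fin n)) :
    ∃ m, CellAdj (dyadicCell k x) m ∧ nbhdMean k F x ≤ 3 ^ n * cellMean F (k, m) := by
  classical
  have hfin : {m | CellAdj (dyadicCell k x) m}.Finite := by
    refine (finite_Icc (dyadicCell k x - 1) (dyadicCell k x + 1)).subset fun m hm => ?_
    constructor <;> intro i <;> have := hm i <;> simp <;> omega
  obtain ⟨m, hm, hmax⟩ := hfin.exists_maximalFor (fun m => cellMean F (k, m)) _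
    ⟨dyadicCell k x, CellAdj.refl _⟩
  refine ⟨m, hm, ?_⟩
  rw [nbhdMean, dyadicNbhd, setLIntegral_dyadicCell_eq_tsum k (CellAdj (dyadicCell k x)),
    ← ENNReal.tsum_mul_left, ← tsum_cellAdj (dyadicCell k x)]
  refine ENNReal.tsum_le_tsum fun m' => ?_
  split_ifs with h
  · rcases le_total (cellMean F (k, m')) (cellMean F (k, m)) with h1 | h1
    · exact h1
    · exact hmax h h1
  · simp

theorem le_mul_of_forall_le_mul_add {a C D : ℝ≥0∞} (hC : C ≠ ∞)
    (h : ∀ η : ℝ≥0∞, η ≠ 0 → a ≤ C * (D + η)) : a ≤ C * D := by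
  refine ENNReal.le_of_forall_pos_le_add fun ε hε _ => ?_
  refine (h (ε / C) (ENNReal.div_ne_zero.2 ⟨by simp [hε.ne'], hC⟩)).trans ?_
  rw [mul_add]
  gcongr
  exact ENNReal.mul_div_le

/-! ### Fractional maximal functions below the top dimension -/

theorem nbhdMean_tsum_eq (w : ℤ × (Fin n → ℤ) → ℝ≥0∞) (k : ℤ) (x : EuclideanSpace ℝ (Fin n)) :
    nbhdMean k (fun y => ∑' j, w (j, dyadicCell j y)) x =
      ∑' q : ℤ × (Fin n → ℤ), w q * (twoPow (k * n) *
        volume ({y | dyadicCell q.1 y = q.2} ∩ dyadicNbhd k x)) := by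
  have h : ∀ y : EuclideanSpace ℝ (Fin n), ∑' j, w (j, dyadicCell j y) =
      ∑' q : ℤ × (Fin n → ℤ), {y | dyadicCell q.1 y = q.2}.indicator (fun _ => w q) y := by
    intro y
    classical
    simp only [indicator_apply, mem_ofPred_eq]
    rw [ENNReal.tsum_prod']
    refine tsum_congr fun j => ?_
    simp only [eq_comm (a := dyadicCell j y)]
    rw [tsum_ite_eq]
  have hm : ∀ q : ℤ × (Fin n → ℤ), AEMeasurable
      ({y : EuclideanSpace ℝ (Fin n) | dyadicCell q.1 y = q.2}.indicator (fun _ => w q))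
      (volume.restrict (dyadicNbhd k x)) := fun q =>
    (measurable_const.indicator (measurableSet_dyadicCell_eq q.1 q.2)).aemeasurable
  rw [funext h, nbhdMean, lintegral_tsum hm, ← ENNReal.tsum_mul_left]
  refine tsum_congr fun q => ?_
  rw [lintegral_indicator_const (measurableSet_dyadicCell_eq q.1 q.2),
    Measure.restrict_apply (measurableSet_dyadicCell_eq q.1 q.2)]
  ring

open Classical in
/-- The share of a dyadic cube `q` in the mean of scale `k` at `x`. If `l` is the coarser one of the
two scales, it vanishes unless the ancestors of scale `l` of `q` and of `x` are adjacent. -/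
theorem overlap_le (k : ℤ) (q : ℤ × (Fin n → ℤ)) (x : EuclideanSpace ℝ (Fin n)) :
    twoPow (k * n) * volume ({y | dyadicCell q.1 y = q.2} ∩ dyadicNbhd k x) ≤
      3 ^ n * (if CellAdj (dyadicCell (min k q.1) (dyadicCorner q.1 q.2)) (dyadicCell (min k q.1) x)
        then twoPow ((((min k q.1 : ℤ) : ℝ) - q.1) * n) else 0) := by
  split_ifs with hadj
  · rcases le_total k q.1 with h | h
    · rw [min_eq_left h]
      calc _ ≤ twoPow (k * n) * volume {y : EuclideanSpace ℝ (Fin n) | dyadicCell q.1 y = q.2} := by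
            gcongr; exact inter_subset_left
        _ = 1 * twoPow ((k - q.1) * n) := by
            rw [volume_dyadicCell_eq, ← twoPow_add, one_mul]; congr 1; ring
        _ ≤ _ := by gcongr; exact one_le_pow₀ (by norm_num)
    · rw [min_eq_right h]
      calc _ ≤ twoPow (k * n) * (3 ^ n * twoPow (-(k * n))) := by
            gcongr; exact (measure_mono inter_subset_right).trans (volume_dyadicNbhd_le k x)
        _ = 3 ^ n * (twoPow (k * n) * twoPow (-(k * n))) := by ring
        _ = _ := by rw [twoPow_mul_neg]; simp
  · have : {y | dyadicCell q.1 y = q.2} ∩ dyadicNbhd k x = ∅ := by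
      refine eq_empty_of_forall_notMem fun y hy => hadj ?_
      obtain ⟨hy1, hy2⟩ := hy
      have h1 : dyadicCell (min k q.1) (dyadicCorner q.1 q.2) = dyadicCell (min k q.1) y :=
        dyadicCell_eq_of_le (min_le_right _ _) (by rw [dyadicCell_dyadicCorner]; exact hy1.symm)
      rw [h1]
      exact CellAdj.of_le (min_le_left _ _) (CellAdj.symm hy2)
    rw [this]; simp

/-- The two estimates behind the Hedberg argument, for the dimension `δ < n`: a pointwise bound
for averages, and the strong type bound for the fractional maximal function of order `κ`. Since
`δ < n`, there is an exponent `s ≤ 1`, `s ≤ p` with `δ < n s`; for such an exponent the `s`-th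
powers of averages are subadditive, so that it suffices to treat single dyadic cubes. -/
theorem exists_nbhdMean_bounds_of_lt {δ κ p : ℝ} (hδ : 0 < δ) (hδn : δ < n) (hκ : 0 ≤ κ)
    (hp : δ / n < p) (hσ : 0 < δ - κ * p) :
    ∃ C : ℝ≥0∞, C ≠ ∞ ∧ ∀ F : EuclideanSpace ℝ (Fin n) → ℝ≥0∞, AEMeasurable F volume →
      (∀ k x, nbhdMean k F x ^ p ≤
        C * (twoPow (k * δ) * choquetIntegral (hausdorffContent δ) (fun x => F x ^ p))) ∧
      choquetIntegral (hausdorffContent (δ - κ * p))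
        (fun x => ⨆ k : ℤ, twoPow (-(k * (κ * p))) * nbhdMean k F x ^ p) ≤
        C * choquetIntegral (hausdorffContent δ) (fun x => F x ^ p) := by
  classical
  have hn0 : (0 : ℝ) < n := hδ.trans hδn
  have hp0 : 0 < p := (div_pos hδ hn0).trans hp
  set s := min p 1 with hsdef
  have hs0 : 0 < s := lt_min hp0 one_pos
  have hs1 : s ≤ 1 := min_le_right _ _
  have hsp : s ≤ p := min_le_left _ _
  have hns : δ < n * s := by
    have : δ / n < s := lt_min hp (by rwa [div_lt_one hn0])
    rwa [div_lt_iff₀ hn0, mul_comm] at this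
  have hr : 1 ≤ p / s := by rwa [one_le_div hs0]
  obtain ⟨C₁, hC₁, hmaj⟩ := exists_dyadic_majorant n hδ hs0 hs1
  obtain ⟨C₂, hC₂, hK⟩ := exists_choquetIntegral_tsum_le n hσ
  set K : ℝ≥0∞ := ((3 ^ n) ^ (p / s - 1)) ^ s * (3 ^ n) ^ s with hKdef
  have hKt : K ≠ ∞ := by
    have h1 : (0 : ℝ) ≤ p / s - 1 := by linarith
    have h2 := hs0.le
    finiteness
  have hgeom := geomSum_ne_top (sub_pos.2 hns)
  -- Jensen's inequality and subadditivity reduce the mean to the shares of single cubes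
  have hmean : ∀ F : EuclideanSpace ℝ (Fin n) → ℝ≥0∞, AEMeasurable F volume →
      ∀ w : ℤ × (Fin n → ℤ) → ℝ≥0∞, (∀ x, F x ^ p ≤ (∑' k, w (k, dyadicCell k x)) ^ s) →
      ∀ k x, nbhdMean k F x ^ p ≤ K * ∑' q : ℤ × (Fin n → ℤ), w q ^ s *
        (if CellAdj (dyadicCell (min k q.1) (dyadicCorner q.1 q.2)) (dyadicCell (min k q.1) x)
        then twoPow ((((min k q.1 : ℤ) : ℝ) - q.1) * (n * s)) else 0) := by
    intro F hF w hw k x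
    have hFr : ∀ y, F y ^ (p / s) ≤ ∑' k, w (k, dyadicCell k y) := fun y => by
      have := ENNReal.rpow_le_rpow (hw y) (inv_nonneg.2 hs0.le)
      rwa [ENNReal.rpow_rpow_inv hs0.ne', ← ENNReal.rpow_mul, ← div_eq_mul_inv] at this
    calc nbhdMean k F x ^ p = (nbhdMean k F x ^ (p / s)) ^ s := by
          rw [← ENNReal.rpow_mul, div_mul_cancel₀ _ hs0.ne']
      _ ≤ ((3 ^ n) ^ (p / s - 1) *
            nbhdMean k (fun y => ∑' j, w (j, dyadicCell j y)) x) ^ s := by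
          refine ENNReal.rpow_le_rpow ((nbhdMean_rpow_le hF hr k x).trans ?_) hs0.le
          refine mul_le_mul_right (mul_le_mul_right (lintegral_mono hFr) _) _
      _ ≤ ((3 ^ n) ^ (p / s - 1)) ^ s * ∑' q : ℤ × (Fin n → ℤ), (w q * (3 ^ n *
            (if CellAdj (dyadicCell (min k q.1) (dyadicCorner q.1 q.2)) (dyadicCell (min k q.1) x)
            then twoPow ((((min k q.1 : ℤ) : ℝ) - q.1) * n) else 0))) ^ s := by
          rw [ENNReal.mul_rpow_of_nonneg _ _ hs0.le, nbhdMean_tsum_eq]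
          refine mul_le_mul_right ((rpow_tsum_le_tsum_rpow _ hs0 hs1).trans ?_) _
          refine ENNReal.tsum_le_tsum fun q => ENNReal.rpow_le_rpow ?_ hs0.le
          exact mul_le_mul_right (overlap_le k q x) _
      _ = _ := by
          rw [hKdef, mul_assoc, ← ENNReal.tsum_mul_left (a := (3 ^ n) ^ s)]
          congr 1
          refine tsum_congr fun q => ?_
          rw [ENNReal.mul_rpow_of_nonneg _ _ hs0.le, ENNReal.mul_rpow_of_nonneg _ _ hs0.le]
          split_ifs
          · rw [twoPow_rpow, mul_assoc _ (n : ℝ) s]; ring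
          · simp [hs0]
  set C : ℝ≥0∞ := K * C₁ + C₂ * (K * (3 ^ n * geomSum (n * s - δ)) * C₁) with hCdef
  have hC : C ≠ ∞ := by finiteness
  refine ⟨C, hC, fun F hF => ?_⟩
  have hmajF := hmaj fun x => F x ^ p
  generalize choquetIntegral (hausdorffContent δ) (fun x => F x ^ p) = D at hmajF ⊢
  refine ⟨fun k x => ?_, ?_⟩
  · rw [mul_left_comm, ← mul_assoc, mul_comm (twoPow _)]
    refine le_mul_of_forall_le_mul_add (ENNReal.mul_ne_top hC (by simp)) fun η hη => ?_
    obtain ⟨w, hw1, hw2⟩ := hmajF η hη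
    calc _ ≤ _ := hmean F hF w hw1 k x
      _ ≤ K * ∑' q : ℤ × (Fin n → ℤ), twoPow (k * δ) * (w q ^ s * twoPow (-(q.1 * δ))) := by
          refine mul_le_mul_right (ENNReal.tsum_le_tsum fun q => ?_) _
          rw [mul_left_comm (twoPow (k * δ)), ← twoPow_add]
          refine mul_le_mul_right ?_ _
          split_ifs
          · refine twoPow_mono ?_
            have h1 : ((min k q.1 : ℤ) : ℝ) ≤ q.1 := by exact_mod_cast min_le_right _ _
            have h2 : ((min k q.1 : ℤ) : ℝ) ≤ k := by exact_mod_cast min_le_left _ _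
            nlinarith
          · exact bot_le
      _ = twoPow (k * δ) * (K * ∑' q : ℤ × (Fin n → ℤ), (w q ^ s * twoPow (-(q.1 * δ)))) := by
          rw [ENNReal.tsum_mul_left]; ring
      _ ≤ twoPow (k * δ) * (K * (C₁ * (D + η))) := by gcongr
      _ = K * C₁ * twoPow (k * δ) * (D + η) := by ring
      _ ≤ _ := by gcongr; exact le_self_add
  · refine le_mul_of_forall_le_mul_add hC fun η hη => ?_
    obtain ⟨w, hw1, hw2⟩ := hmajF η hη
    -- the weight of a cube `u` collects the shares of the cubes `q` whose ancestors are adjacent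
    -- to `u`; a mean at a scale finer than that of `q` is absorbed by the term at the scale of `q`
    set W : ℤ × (Fin n → ℤ) → ℝ≥0∞ := fun u => K * ∑' q : ℤ × (Fin n → ℤ), w q ^ s *
      (if u.1 ≤ q.1 then
        (if CellAdj (dyadicCell u.1 (dyadicCorner q.1 q.2)) u.2
          then twoPow (-(u.1 * (κ * p)) + (u.1 - q.1) * (n * s)) else 0) else 0) with hW
    have hsup : ∀ x, (⨆ k : ℤ, twoPow (-(k * (κ * p))) * nbhdMean k F x ^ p) ≤
        ∑' l : ℤ, W (l, dyadicCell l x) := by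
      refine fun x => iSup_le fun k => ?_
      refine (mul_le_mul_right (hmean F hF w hw1 k x) _).trans ?_
      rw [mul_left_comm]
      simp only [hW]
      rw [ENNReal.tsum_mul_left, ENNReal.tsum_comm, ← ENNReal.tsum_mul_left]
      refine mul_le_mul_right (ENNReal.tsum_le_tsum fun q => ?_) _
      rw [ENNReal.tsum_mul_left, mul_left_comm]
      refine mul_le_mul_right ?_ _
      refine le_trans ?_ (ENNReal.le_tsum (min k q.1))
      rw [if_pos (min_le_right _ _)]
      split_ifs
      · rw [← twoPow_add]
        refine twoPow_mono ?_
        have h2 : ((min k q.1 : ℤ) : ℝ) ≤ k := by exact_mod_cast min_le_left _ _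
        have h3 : 0 ≤ κ * p := mul_nonneg hκ hp0.le
        nlinarith
      · simp
    refine (choquetIntegral_mono (hausdorffContent_mono _) hsup).trans ((hK W).trans ?_)
    have hsum : ∑' u, W u * twoPow (-(u.1 * (δ - κ * p))) =
        K * ∑' q : ℤ × (Fin n → ℤ), w q ^ s * (twoPow (-(q.1 * δ)) *
          (3 ^ n * geomSum (n * s - δ))) := by
      simp only [hW, mul_assoc K]
      rw [ENNReal.tsum_mul_left]
      congr 1
      simp only [← ENNReal.tsum_mul_right]
      rw [ENNReal.tsum_comm]
      refine tsum_congr fun q => ?_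
      simp only [mul_assoc (w q ^ s)]
      rw [ENNReal.tsum_mul_left, ENNReal.tsum_prod']
      congr 1
      rw [← tsum_int_le_eq_geomSum _ q.1, ← ENNReal.tsum_mul_left, ← ENNReal.tsum_mul_left]
      refine tsum_congr fun l => ?_
      simp only
      split_ifs with hl
      · simp only [ite_mul, zero_mul]
        rw [tsum_cellAdj, mul_left_comm (twoPow (-(q.1 * δ))), ← twoPow_add,
          ← twoPow_add]
        congr 2; ring
      · simp
    rw [hsum]
    simp only [← mul_assoc (w _ ^ s)]
    rw [ENNReal.tsum_mul_right]
    calc C₂ * (K * ((∑' q : ℤ × (Fin n → ℤ), w q ^ s * twoPow (-(q.1 * δ))) *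
          (3 ^ n * geomSum (n * s - δ))))
        ≤ C₂ * (K * ((C₁ * (D + η)) *
          (3 ^ n * geomSum (n * s - δ)))) := by gcongr
      _ = C₂ * (K * (3 ^ n * geomSum (n * s - δ)) * C₁) * (D + η) := by ring
      _ ≤ _ := by gcongr; exact le_add_self

/-! ### Fractional maximal functions in the top dimension -/

theorem exists_forall_twoPow_mul_lt {σ : ℝ} (hσ : 0 < σ) {I t : ℝ≥0∞} (hI : I ≠ ∞) (ht : 0 < t) :
    ∃ K : ℤ, ∀ j ≤ K, twoPow (j * σ) * I < t := by
  have h1 : twoPow (-σ) < 1 :=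
    ENNReal.rpow_lt_one_of_one_lt_of_neg (by norm_num) (by linarith)
  have h2 := ENNReal.Tendsto.mul_const (b := I)
    (ENNReal.tendsto_pow_atTop_nhds_zero_of_lt_one h1) (Or.inr hI)
  rw [zero_mul] at h2
  obtain ⟨m, hm⟩ := ((tendsto_order.1 h2).2 t ht).exists
  refine ⟨-m, fun j hj => lt_of_le_of_lt ?_ hm⟩
  rw [← ENNReal.rpow_natCast, twoPow_rpow]
  refine mul_le_mul_left (twoPow_mono ?_) _
  have : (j : ℝ) ≤ -m := by exact_mod_cast hj
  nlinarith

/-- The heights `τ` for which the dyadic cube `q` is a maximal cube with `τ < cellMean F q`. -/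
def stoppingHeights (F : EuclideanSpace ℝ (Fin n) → ℝ≥0∞) (q : ℤ × (Fin n → ℤ)) : Set ℝ :=
  {τ | ENNReal.ofReal τ < cellMean F q ∧
    ∀ j < q.1, cellMean F (j, dyadicCell j (dyadicCorner q.1 q.2)) ≤ ENNReal.ofReal τ}

/-- For a maximal cube at height `τ`, the part of the average above the height `τ / 2` is at least
`τ / 2`. -/
theorem twoPow_le_of_mem_stoppingHeights (F : EuclideanSpace ℝ (Fin n) → ℝ≥0∞)
    {q : ℤ × (Fin n → ℤ)} {τ : ℝ} (hτ0 : 0 < τ) (hτ : τ ∈ stoppingHeights F q) :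
    twoPow (-(q.1 * n)) ≤ ENNReal.ofReal (2 / τ) * ∫⁻ y in {y | dyadicCell q.1 y = q.2},
      {y | ENNReal.ofReal (τ / 2) < F y}.indicator F y := by
  set G := {y | ENNReal.ofReal (τ / 2) < F y}.indicator F with hG
  have hle : ∀ y, F y ≤ G y + ENNReal.ofReal (τ / 2) := fun y => by
    classical
    by_cases h : ENNReal.ofReal (τ / 2) < F y
    · rw [hG, indicator_of_mem (by exact h)]; exact le_self_add
    · exact (not_lt.1 h).trans le_add_self
  have h1 : cellMean F q ≤ twoPow (q.1 * n) * (∫⁻ y in {y | dyadicCell q.1 y = q.2}, G y)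
      + ENNReal.ofReal (τ / 2) := by
    calc _ ≤ twoPow (q.1 * n) * ∫⁻ y in {y | dyadicCell q.1 y = q.2},
            (G y + ENNReal.ofReal (τ / 2)) := mul_le_mul_right (lintegral_mono hle) _
      _ = _ := by
        rw [lintegral_add_right _ measurable_const, lintegral_const, Measure.restrict_apply_univ,
          volume_dyadicCell_eq, mul_add, mul_left_comm, twoPow_mul_neg, mul_one]
  have h2 : ENNReal.ofReal (τ / 2) + ENNReal.ofReal (τ / 2) ≤
      twoPow (q.1 * n) * (∫⁻ y in {y | dyadicCell q.1 y = q.2}, G y)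
        + ENNReal.ofReal (τ / 2) := by
    rw [← ENNReal.ofReal_add (by positivity) (by positivity), add_halves]
    exact hτ.1.le.trans h1
  have h3 := (ENNReal.add_le_add_iff_right ENNReal.ofReal_ne_top).1 h2
  calc twoPow (-(q.1 * n)) = twoPow (-(q.1 * n)) * (ENNReal.ofReal (2 / τ) *
        ENNReal.ofReal (τ / 2)) := by
        rw [← ENNReal.ofReal_mul (by positivity), show 2 / τ * (τ / 2) = 1 by field_simp]
        simp
    _ ≤ twoPow (-(q.1 * n)) * (ENNReal.ofReal (2 / τ) *
        (twoPow (q.1 * n) * (∫⁻ y in {y | dyadicCell q.1 y = q.2}, G y))) := by gcongr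
    _ = (twoPow (-(q.1 * n)) * twoPow (q.1 * n)) * (ENNReal.ofReal (2 / τ) *
        (∫⁻ y in {y | dyadicCell q.1 y = q.2}, G y)) := by ring
    _ = _ := by rw [twoPow_neg_mul, one_mul]

/-- The maximal cubes at a given height are disjoint, so that their total volume is controlled by
a single integral. -/
theorem tsum_stoppingHeights_le (F : EuclideanSpace ℝ (Fin n) → ℝ≥0∞) {τ : ℝ} (hτ0 : 0 < τ) :
    ∑' q : ℤ × (Fin n → ℤ), (stoppingHeights F q).indicator (fun _ => twoPow (-(q.1 * n))) τ ≤
      ENNReal.ofReal (2 / τ) * ∫⁻ y, {y | ENNReal.ofReal (τ / 2) < F y}.indicator F y := by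
  classical
  have hle : ∀ q : ℤ × (Fin n → ℤ),
      (stoppingHeights F q).indicator (fun _ => twoPow (-(q.1 * n))) τ ≤
      ENNReal.ofReal (2 / τ) * ∫⁻ y in {y | dyadicCell q.1 y = q.2} ∩ {_y | τ ∈ stoppingHeights F q},
        {y | ENNReal.ofReal (τ / 2) < F y}.indicator F y := fun q => by
    by_cases h : τ ∈ stoppingHeights F q
    · rw [indicator_of_mem h]
      simpa [h] using twoPow_le_of_mem_stoppingHeights F hτ0 h
    · rw [indicator_of_notMem h]; exact bot_le
  have hlt : ∀ q q' : ℤ × (Fin n → ℤ), τ ∈ stoppingHeights F q → τ ∈ stoppingHeights F q' →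
      ∀ y, dyadicCell q.1 y = q.2 → dyadicCell q'.1 y = q'.2 → ¬ q.1 < q'.1 := by
    intro q q' h h' y hy hy' hlt
    have h1 := h'.2 q.1 hlt
    have h2 : dyadicCell q.1 (dyadicCorner q'.1 q'.2) = q.2 :=
      (dyadicCell_eq_of_le hlt.le (by rw [dyadicCell_dyadicCorner, hy'])).trans hy
    rw [h2] at h1
    exact absurd h.1 (not_lt.2 h1)
  refine (ENNReal.tsum_le_tsum hle).trans ?_
  rw [ENNReal.tsum_mul_left, ← lintegral_iUnion]
  · exact mul_le_mul_right (lintegral_mono' Measure.restrict_le_self le_rfl) _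
  · exact fun q => (measurableSet_dyadicCell_eq q.1 q.2).inter (.const _)
  · intro q q' hne
    refine disjoint_left.2 fun y hy hy' => hne ?_
    have h1 := hlt q q' hy.2 hy'.2 y hy.1 hy'.1
    have h2 := hlt q' q hy'.2 hy.2 y hy'.1 hy.1
    have h3 : q.1 = q'.1 := le_antisymm (not_lt.1 h2) (not_lt.1 h1)
    refine Prod.ext h3 ?_
    rw [← show dyadicCell q.1 y = q.2 from hy.1, ← show dyadicCell q'.1 y = q'.2 from hy'.1, h3]

/-- Tonelli's theorem and the integration of `τ ^ (p - 2)` over `0 < τ < 2 F(y)`, as in Doob's maximal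
inequality. -/
theorem lintegral_stopping_eq {p : ℝ} (hp : 1 < p) {F : EuclideanSpace ℝ (Fin n) → ℝ≥0∞}
    (hF : Measurable F) :
    ∫⁻ τ in Ioi (0 : ℝ), ENNReal.ofReal (p * τ ^ (p - 1)) *
      (ENNReal.ofReal (2 / τ) * ∫⁻ y, {y | ENNReal.ofReal (τ / 2) < F y}.indicator F y) =
      ENNReal.ofReal (2 * p / (p - 1)) * 2 ^ (p - 1) * ∫⁻ y, F y ^ p := by
  have hp1 : 0 < p - 1 := by linarith
  have hms : MeasurableSet {z : ℝ × EuclideanSpace ℝ (Fin n) |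
      ENNReal.ofReal (z.1 / 2) < F z.2} :=
    measurableSet_lt (by fun_prop) (hF.comp measurable_snd)
  set c : ℝ → ℝ≥0∞ := fun τ => ENNReal.ofReal (p * τ ^ (p - 1)) * ENNReal.ofReal (2 / τ) with hc
  have hcm : Measurable c := by fun_prop
  set Φ : ℝ × EuclideanSpace ℝ (Fin n) → ℝ≥0∞ := fun z => c z.1 *
    {z : ℝ × EuclideanSpace ℝ (Fin n) | ENNReal.ofReal (z.1 / 2) < F z.2}.indicator
      (fun z => F z.2) z with hΦ
  have hΦm : Measurable Φ :=
    (hcm.comp measurable_fst).mul ((hF.comp measurable_snd).indicator hms)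
  have hleft : ∀ τ, ENNReal.ofReal (p * τ ^ (p - 1)) * (ENNReal.ofReal (2 / τ) *
      ∫⁻ y, {y | ENNReal.ofReal (τ / 2) < F y}.indicator F y) = ∫⁻ y, Φ (τ, y) := fun τ => by
    rw [← mul_assoc, ← lintegral_const_mul' _ _ (by finiteness)]
    rfl
  simp_rw [hleft]
  rw [lintegral_lintegral_swap hΦm.aemeasurable, ← lintegral_const_mul' _ _ (by finiteness)]
  refine lintegral_congr fun y => ?_
  -- the integral over the heights is the substitution `t = τ ^ (p - 1)` in `∫_0^{(2 F)^(p-1)} dt`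
  have hsub := lintegral_Ioi_rpow_subst
    ({t : ℝ | ENNReal.ofReal t < (2 * F y) ^ (p - 1)}.indicator 1) one_pos hp1
  have hmt : MeasurableSet {t : ℝ | ENNReal.ofReal t < (2 * F y) ^ (p - 1)} :=
    measurableSet_lt (by fun_prop) measurable_const
  have hl : ∫⁻ t in Ioi (0 : ℝ),
      ({t : ℝ | ENNReal.ofReal t < (2 * F y) ^ (p - 1)}.indicator 1 t : ℝ≥0∞) =
      (2 * F y) ^ (p - 1) := by
    rw [lintegral_indicator_one hmt, Measure.restrict_apply hmt, inter_comm]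
    exact volume_setOf_ofReal_lt _
  rw [hl] at hsub
  have hpt : ∀ τ ∈ Ioi (0 : ℝ), Φ (τ, y) = ENNReal.ofReal (2 * p / (p - 1)) * F y *
      (ENNReal.ofReal (1 * ((p - 1) * τ ^ (p - 1 - 1))) *
      {t : ℝ | ENNReal.ofReal t < (2 * F y) ^ (p - 1)}.indicator 1 (1 * τ ^ (p - 1))) := by
    intro τ hτ
    have hτ0 : 0 < τ := hτ
    have hiff : ENNReal.ofReal (τ / 2) < F y ↔
        ENNReal.ofReal (1 * τ ^ (p - 1)) < (2 * F y) ^ (p - 1) := by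
      rw [one_mul, ← ENNReal.ofReal_rpow_of_pos hτ0, ENNReal.rpow_lt_rpow_iff hp1]
      have : ENNReal.ofReal τ = 2 * ENNReal.ofReal (τ / 2) := by
        rw [← ENNReal.ofReal_ofNat, ← ENNReal.ofReal_mul (by norm_num)]
        congr 1; ring
      rw [this, ENNReal.mul_lt_mul_iff_right two_ne_zero (by simp)]
    by_cases h : ENNReal.ofReal (τ / 2) < F y
    · have h' := hiff.1 h
      have e1 : Φ (τ, y) = c τ * F y := by
        simp only [hΦ]
        rw [indicator_of_mem (by exact h)]
      rw [e1, indicator_of_mem (by exact h'), Pi.one_apply, mul_one,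
        mul_right_comm (ENNReal.ofReal (2 * p / (p - 1))), ← ENNReal.ofReal_mul (by positivity), hc]
      simp only
      rw [← ENNReal.ofReal_mul (by positivity)]
      congr 2
      rw [Real.rpow_sub_one hτ0.ne' (p - 1)]
      field_simp
    · have h' := fun h'' => h (hiff.2 h'')
      have e1 : Φ (τ, y) = 0 := by
        simp only [hΦ]
        rw [indicator_of_notMem (by exact h), mul_zero]
      rw [e1, indicator_of_notMem (by exact h'), mul_zero, mul_zero]
  rw [setLIntegral_congr_fun measurableSet_Ioi hpt, lintegral_const_mul _, ← hsub,
    ENNReal.mul_rpow_of_nonneg _ _ hp1.le]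
  · have : F y ^ p = F y * F y ^ (p - 1) := by
      conv_lhs => rw [show p = 1 + (p - 1) by ring,
        ENNReal.rpow_add_of_nonneg _ _ zero_le_one hp1.le, ENNReal.rpow_one]
    rw [this]; ring
  · refine Measurable.mul (by fun_prop) ?_
    exact (measurable_one.indicator hmt).comp (by fun_prop)

/-- The strong type bound for the fractional maximal function of order `κ` in the top dimension,
where Choquet integrals of the argument are Lebesgue integrals. The superlevel sets are covered by
the neighbours of maximal cubes; after the substitution `t = 2 ^ (-k κ p) τ ^ p` in the level, which
depends on the scale `k` of the cube, a maximal cube at level `t` is a maximal cube for the plain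
average at height `τ`, and the proof is that of Doob's maximal inequality. -/
theorem exists_choquetIntegral_iSup_nbhdMean_le (n : ℕ) {κ p : ℝ} (hκ : 0 ≤ κ) (hp : 1 < p)
    (hσ : 0 < n - κ * p) :
    ∃ C : ℝ≥0∞, C ≠ ∞ ∧ ∀ F : EuclideanSpace ℝ (Fin n) → ℝ≥0∞, AEMeasurable F volume →
      choquetIntegral (hausdorffContent (n - κ * p))
        (fun x => ⨆ k : ℤ, twoPow (-(k * (κ * p))) * nbhdMean k F x ^ p) ≤
        C * ∫⁻ x, F x ^ p := by
  have hp0 : 0 < p := by linarith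
  obtain ⟨C₁, hC₁, hcov⟩ := exists_choquetIntegral_le_of_dyadic_cover n hσ
  set K : ℝ≥0∞ := (3 ^ n) ^ p with hK
  have hKt : K ≠ ∞ := by finiteness
  have hK0 : K ≠ 0 := by simp [hK]
  set C₂ : ℝ≥0∞ := ENNReal.ofReal (2 * p / (p - 1)) * 2 ^ (p - 1) with hC₂
  have hC₂t : C₂ ≠ ∞ := by
    have : 0 ≤ p - 1 := by linarith
    finiteness
  -- the constant is made nonzero, so that only finite integrals matter
  refine ⟨K * (C₁ * C₂) + 1, by finiteness, fun F hF => ?_⟩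
  wlog hFm : Measurable F generalizing F
  · have h := this (hF.mk F) hF.measurable_mk.aemeasurable hF.measurable_mk
    have e : ∀ k x, nbhdMean k F x = nbhdMean k (hF.mk F) x := fun k x =>
      nbhdMean_congr_ae hF.ae_eq_mk k x
    have e' : ∫⁻ x, F x ^ p = ∫⁻ x, hF.mk F x ^ p := lintegral_congr_ae (by
      filter_upwards [hF.ae_eq_mk] with x hx
      rw [hx])
    simp only [e, e']
    exact h
  by_cases hfin : ∫⁻ x, F x ^ p = ∞
  · rw [hfin, ENNReal.mul_top (by simp)]; exact le_top
  set b : ℤ × (Fin n → ℤ) → ℝ≥0∞ := fun q => twoPow (-(q.1 * (κ * p))) * cellMean F q ^ p with hb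
  -- reduction to averages over adjacent cubes
  have hred : ∀ x, (⨆ k : ℤ, twoPow (-(k * (κ * p))) * nbhdMean k F x ^ p) ≤
      K * ⨆ (k : ℤ) (m : {m // CellAdj (dyadicCell k x) m}), b (k, m) := by
    refine fun x => iSup_le fun k => ?_
    obtain ⟨m, hm, hle⟩ := exists_nbhdMean_le_cellMean F k x
    calc _ ≤ twoPow (-(k * (κ * p))) * (3 ^ n * cellMean F (k, m)) ^ p := by gcongr
      _ = K * b (k, m) := by
        rw [ENNReal.mul_rpow_of_nonneg _ _ hp0.le, hK, hb]; ring
      _ ≤ _ := by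
        gcongr
        exact le_iSup_of_le k (le_iSup_of_le (⟨m, hm⟩ : {m // CellAdj (dyadicCell k x) m}) le_rfl)
  refine (choquetIntegral_mono (hausdorffContent_mono _) hred).trans ?_
  rw [choquetIntegral_const_mul hK0 hKt]
  -- the levels for which `q` is a maximal cube with respect to `b`
  set S : ℤ × (Fin n → ℤ) → Set ℝ := fun q => {t | ENNReal.ofReal t < b q ∧
    ∀ j < q.1, b (j, dyadicCell j (dyadicCorner q.1 q.2)) ≤ ENNReal.ofReal t} with hS
  have hSm : ∀ q, MeasurableSet (S q) := fun q => by
    have h2 : MeasurableSet {t : ℝ | ∀ j : ℤ, j < q.1 →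
        b (j, dyadicCell j (dyadicCorner q.1 q.2)) ≤ ENNReal.ofReal t} := by
      simp only [ofPred_forall]
      exact MeasurableSet.iInter fun j => MeasurableSet.iInter fun _ =>
        measurableSet_le measurable_const ENNReal.measurable_ofReal
    exact (measurableSet_lt ENNReal.measurable_ofReal measurable_const).inter h2
  have hRm : ∀ q, MeasurableSet (stoppingHeights F q) := fun q => by
    have h2 : MeasurableSet {t : ℝ | ∀ j : ℤ, j < q.1 →
        cellMean F (j, dyadicCell j (dyadicCorner q.1 q.2)) ≤ ENNReal.ofReal t} := by
      simp only [ofPred_forall]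
      exact MeasurableSet.iInter fun j => MeasurableSet.iInter fun _ =>
        measurableSet_le measurable_const ENNReal.measurable_ofReal
    exact (measurableSet_lt ENNReal.measurable_ofReal measurable_const).inter h2
  have hmain : ∀ q : ℤ × (Fin n → ℤ), twoPow (-(q.1 * (n - κ * p))) * volume (Ioi 0 ∩ S q) ≤
      ∫⁻ τ in Ioi (0 : ℝ), ENNReal.ofReal (p * τ ^ (p - 1)) *
        (stoppingHeights F q).indicator (fun _ => twoPow (-(q.1 * n))) τ := by
    intro q
    have hc : (0 : ℝ) < 2 ^ (-(q.1 * (κ * p))) := Real.rpow_pos_of_pos two_pos _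
    rw [inter_comm, ← Measure.restrict_apply (hSm q), ← lintegral_indicator_one (hSm q),
      lintegral_Ioi_rpow_subst _ hc hp0, ← lintegral_const_mul' _ _ (by simp)]
    refine setLIntegral_mono' measurableSet_Ioi fun τ hτ => ?_
    have hτ0 : 0 < τ := hτ
    have hval : ENNReal.ofReal (2 ^ (-(q.1 * (κ * p))) * τ ^ p) =
        twoPow (-(q.1 * (κ * p))) * ENNReal.ofReal τ ^ p := by
      rw [ENNReal.ofReal_mul hc.le, twoPow_eq_ofReal, ENNReal.ofReal_rpow_of_pos hτ0]
    by_cases hmem : (2 : ℝ) ^ (-(q.1 * (κ * p))) * τ ^ p ∈ S q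
    · have hmem' : τ ∈ stoppingHeights F q := by
        obtain ⟨h1, h2⟩ := hmem
        rw [hval] at h1
        constructor
        · have := (ENNReal.mul_lt_mul_iff_right (twoPow_ne_zero _) (twoPow_ne_top _)).1 h1
          exact (ENNReal.rpow_lt_rpow_iff hp0).1 this
        · intro j hj
          have h3 := h2 j hj
          rw [hval] at h3
          have h4 : twoPow (-(q.1 * (κ * p))) ≤ twoPow (-(j * (κ * p))) := by
            refine twoPow_mono ?_
            have : (j : ℝ) ≤ q.1 := by exact_mod_cast hj.le
            have h5 : 0 ≤ κ * p := mul_nonneg hκ hp0.le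
            nlinarith
          have h6 := h3.trans (mul_le_mul_left h4 _)
          have := (ENNReal.mul_le_mul_iff_right (twoPow_ne_zero _) (twoPow_ne_top _)).1 h6
          exact (ENNReal.rpow_le_rpow_iff hp0).1 this
      rw [indicator_of_mem hmem, indicator_of_mem hmem', ENNReal.ofReal_mul hc.le,
        ← twoPow_eq_ofReal, Pi.one_apply, mul_one, ← mul_assoc, ← twoPow_add, mul_comm]
      refine mul_le_mul_right (twoPow_mono ?_) _
      linarith
    · rw [indicator_of_notMem hmem]; simp
  calc _ ≤ K * (C₁ * ∑' q : ℤ × (Fin n → ℤ),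
        twoPow (-(q.1 * (n - κ * p))) * volume (Ioi 0 ∩ S q)) := by
        gcongr
        refine hcov _ S hSm fun t ht x hx => ?_
        simp only [lt_iSup_iff] at hx
        obtain ⟨k, ⟨m, hm⟩, hkm⟩ := hx
        set z := dyadicCorner k m with hz
        have hdecay : ∀ j, b (j, dyadicCell j z) ≤
            twoPow (j * (n - κ * p)) * ∫⁻ x, F x ^ p := fun j => by
          calc _ ≤ twoPow (-(j * (κ * p))) * (twoPow (j * n) * ∫⁻ x, F x ^ p) := by
                simp only [hb]
                gcongr
                exact cellMean_rpow_le hFm.aemeasurable hp.le _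
            _ = _ := by
                rw [← mul_assoc, ← twoPow_add]; congr 2; ring
        -- the decay of `b` towards large cubes yields a maximal cube that contains the given one
        obtain ⟨J, hJ⟩ := exists_forall_twoPow_mul_lt hσ hfin (ENNReal.ofReal_pos.2 ht)
        obtain ⟨l, hl, hmin⟩ := Int.exists_least_of_bdd
          (P := fun j => ENNReal.ofReal t < b (j, dyadicCell j z))
          ⟨J, fun j hj => le_of_not_ge fun hjJ =>
            absurd (hj.trans_le (hdecay j)) (hJ j hjJ).not_gt⟩
          ⟨k, by simpa [hz] using hkm⟩
        have hlk : l ≤ k := hmin k (by simpa [hz] using hkm)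
        refine ⟨(l, dyadicCell l z), ⟨hl, fun j hj => ?_⟩, ?_⟩
        · have : dyadicCell j (dyadicCorner l (dyadicCell l z)) = dyadicCell j z :=
            dyadicCell_eq_of_le (j := l) (le_of_lt hj) (by simp)
          simp only [this]
          exact not_lt.1 fun h => absurd (hmin j h) (not_le.2 hj)
        · refine CellAdj.of_le hlk (x := x) (y := z) ?_
          simpa [hz] using hm
    _ ≤ K * (C₁ * ∑' q : ℤ × (Fin n → ℤ), ∫⁻ τ in Ioi (0 : ℝ), ENNReal.ofReal (p * τ ^ (p - 1)) *
        (stoppingHeights F q).indicator (fun _ => twoPow (-(q.1 * n))) τ) := by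
        gcongr with q
        exact hmain q
    _ = K * (C₁ * ∫⁻ τ in Ioi (0 : ℝ), ENNReal.ofReal (p * τ ^ (p - 1)) * ∑' q : ℤ × (Fin n → ℤ),
        (stoppingHeights F q).indicator (fun _ => twoPow (-(q.1 * n))) τ) := by
        rw [← lintegral_tsum fun q => ?_]
        · simp only [ENNReal.tsum_mul_left]
        · exact (Measurable.mul (by fun_prop) (measurable_const.indicator (hRm q))).aemeasurable
    _ ≤ K * (C₁ * (C₂ * ∫⁻ x, F x ^ p)) := by
        rw [hC₂, ← lintegral_stopping_eq hp hFm]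
        gcongr K * (C₁ * ?_)
        refine setLIntegral_mono' measurableSet_Ioi fun τ hτ => ?_
        exact mul_le_mul_right (tsum_stoppingHeights_le F hτ) _
    _ ≤ _ := by
        rw [← mul_assoc C₁, ← mul_assoc K]
        gcongr
        exact le_self_add

/-- The two estimates behind the Hedberg argument, in the top dimension. -/
theorem exists_nbhdMean_bounds_of_eq {n : ℕ} (hn : 1 ≤ n) {κ p : ℝ} (hκ : 0 ≤ κ) (hp : 1 < p)
    (hσ : 0 < n - κ * p) :
    ∃ C : ℝ≥0∞, C ≠ ∞ ∧ ∀ F : EuclideanSpace ℝ (Fin n) → ℝ≥0∞, AEMeasurable F volume →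
      (∀ k x, nbhdMean k F x ^ p ≤
        C * (twoPow (k * n) * choquetIntegral (hausdorffContent n) (fun x => F x ^ p))) ∧
      choquetIntegral (hausdorffContent (n - κ * p))
        (fun x => ⨆ k : ℤ, twoPow (-(k * (κ * p))) * nbhdMean k F x ^ p) ≤
        C * choquetIntegral (hausdorffContent n) (fun x => F x ^ p) := by
  obtain ⟨C₁, hC₁, hmax⟩ := exists_choquetIntegral_iSup_nbhdMean_le n hκ hp hσ
  obtain ⟨C₂, hC₂, hvol⟩ := exists_volume_le_mul_hausdorffContent hn
  have hp1 : 0 ≤ p - 1 := by linarith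
  refine ⟨((3 ^ n) ^ (p - 1) + C₁) * C₂, by finiteness, fun F hF => ?_⟩
  have hint : ∫⁻ x, F x ^ p ≤ C₂ * choquetIntegral (hausdorffContent n) (fun x => F x ^ p) :=
    (lintegral_le_choquetIntegral volume _).trans (choquetIntegral_mono_content hC₂ hvol _)
  generalize choquetIntegral (hausdorffContent (n : ℝ)) (fun x => F x ^ p) = D at hint ⊢
  refine ⟨fun k x => ?_, ?_⟩
  · calc _ ≤ (3 ^ n) ^ (p - 1) * (twoPow (k * n) * ∫⁻ y in dyadicNbhd k x, F y ^ p) :=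
          nbhdMean_rpow_le hF hp.le k x
      _ ≤ ((3 ^ n) ^ (p - 1) + C₁) * (twoPow (k * n) * (C₂ * D)) := by
          gcongr
          · exact le_self_add
          · exact (lintegral_mono' Measure.restrict_le_self le_rfl).trans hint
      _ = _ := by ring
  · calc _ ≤ C₁ * ∫⁻ x, F x ^ p := hmax F hF
      _ ≤ ((3 ^ n) ^ (p - 1) + C₁) * (C₂ * D) := by
          gcongr
          exact le_add_self
      _ = _ := by ring

/-! ### The Hedberg argument -/

/-- The optimization over the splitting radius in the Hedberg argument: the terms are bounded by
`2 ^ (k β) u` for `k` below the scale at which the two bounds agree, by `2 ^ (-k γ) v` above. -/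
theorem exists_tsum_min_le {β γ : ℝ} (hβ : 0 < β) (hγ : 0 < γ) :
    ∃ C : ℝ≥0∞, C ≠ ∞ ∧ ∀ u v : ℝ≥0∞,
      ∑' k : ℤ, min (twoPow (k * β) * u) (twoPow (-(k * γ)) * v) ≤
        C * (u ^ (γ / (β + γ)) * v ^ (β / (β + γ))) := by
  have hβγ : 0 < β + γ := add_pos hβ hγ
  have hθ : 0 < γ / (β + γ) := div_pos hγ hβγ
  have hθ' : 0 < β / (β + γ) := div_pos hβ hβγ
  have h1 : γ / (β + γ) + β / (β + γ) = 1 := by field_simp; ring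
  have hC : geomSum β + geomSum γ * twoPow γ + 1 ≠ ∞ :=
    ENNReal.add_ne_top.2 ⟨ENNReal.add_ne_top.2
      ⟨geomSum_ne_top hβ, ENNReal.mul_ne_top (geomSum_ne_top hγ) (twoPow_ne_top _)⟩,
      ENNReal.one_ne_top⟩
  refine ⟨_, hC, fun u v => ?_⟩
  -- in the degenerate cases both sides are `0`, or the right-hand side is `∞`
  rcases eq_or_ne u 0 with rfl | hu0
  · simp
  rcases eq_or_ne v 0 with rfl | hv0
  · simp
  rcases eq_or_ne u ∞ with rfl | hut
  · rw [ENNReal.top_rpow_of_pos hθ, ENNReal.top_mul (by simp [hv0, hθ'.le]),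
      ENNReal.mul_top (by simp)]
    exact le_top
  rcases eq_or_ne v ∞ with rfl | hvt
  · rw [ENNReal.top_rpow_of_pos hθ', ENNReal.mul_top (by simp [hu0, hθ.le]),
      ENNReal.mul_top (by simp)]
    exact le_top
  have hb : 1 < twoPow (β + γ) := ENNReal.one_lt_rpow (by norm_num) hβγ
  -- `K` is the scale at which the two bounds agree, up to a factor
  obtain ⟨K, hK, hK'⟩ := ENNReal.exists_mem_Ico_zpow (x := v / u)
    (ENNReal.div_ne_zero.2 ⟨hv0, hut⟩) (ENNReal.div_ne_top hvt hu0) hb (by simp)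
  rw [← ENNReal.rpow_intCast, twoPow_rpow] at hK hK'
  have hKv : twoPow ((β + γ) * K) * u ≤ v := (ENNReal.le_div_iff_mul_le (Or.inl hu0) (Or.inl hut)).1 hK
  have hKv' : v ≤ twoPow ((β + γ) * ((K + 1 : ℤ) : ℝ)) * u :=
    (ENNReal.div_le_iff hu0 hut).1 hK'.le
  set X := u ^ (γ / (β + γ)) * v ^ (β / (β + γ)) with hX
  have hsplit : ∀ z : ℝ≥0∞, z ^ (γ / (β + γ)) * z ^ (β / (β + γ)) = z := fun z => by
    rw [← ENNReal.rpow_add_of_nonneg _ _ hθ.le hθ'.le, h1, ENNReal.rpow_one]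
  have hu : twoPow (K * β) * u ≤ X := by
    calc _ = u ^ (γ / (β + γ)) * (twoPow ((β + γ) * K) * u) ^ (β / (β + γ)) := by
          rw [ENNReal.mul_rpow_of_nonneg _ _ hθ'.le, twoPow_rpow, mul_left_comm, hsplit]
          congr 2; field_simp
      _ ≤ X := by rw [hX]; gcongr
  have hv : v ≤ twoPow (((K + 1 : ℤ) : ℝ) * γ) * X := by
    calc v = v ^ (γ / (β + γ)) * v ^ (β / (β + γ)) := (hsplit v).symm
      _ ≤ (twoPow ((β + γ) * ((K + 1 : ℤ) : ℝ)) * u) ^ (γ / (β + γ)) * v ^ (β / (β + γ)) := by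
          gcongr
      _ = _ := by
          rw [ENNReal.mul_rpow_of_nonneg _ _ hθ.le, twoPow_rpow, hX, mul_assoc]
          congr 2; field_simp
  calc _ ≤ ∑' k : ℤ, ((if k ≤ K then twoPow ((k - K) * β) else 0) * X +
        (if K ≤ k then twoPow ((K - k) * γ) else 0) * (twoPow γ * X)) := by
        refine ENNReal.tsum_le_tsum fun k => ?_
        rcases le_total k K with hk | hk
        · rw [if_pos hk]
          refine (min_le_left _ _).trans (le_trans ?_ le_self_add)
          calc _ = twoPow ((k - K) * β) * (twoPow (K * β) * u) := by
                rw [← mul_assoc, ← twoPow_add]; congr 2; ring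
            _ ≤ _ := by gcongr
        · rw [if_pos hk]
          refine (min_le_right _ _).trans (le_trans ?_ le_add_self)
          calc _ ≤ twoPow (-(k * γ)) * (twoPow (((K + 1 : ℤ) : ℝ) * γ) * X) := by gcongr
            _ = _ := by
              rw [← mul_assoc, ← twoPow_add, ← mul_assoc (twoPow ((K - k) * γ)), ← twoPow_add]
              congr 2; push_cast; ring
    _ = (geomSum β + geomSum γ * twoPow γ) * X := by
        rw [ENNReal.tsum_add, ENNReal.tsum_mul_right, ENNReal.tsum_mul_right,
          tsum_int_le_eq_geomSum, tsum_int_ge_eq_geomSum]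
        ring
    _ ≤ _ := mul_le_mul_left le_self_add _

/-- The Riesz potential is dominated by a sum of averages over dyadic neighbourhoods. -/
theorem lintegral_div_rpow_le (hn : 1 ≤ n) {α : ℝ} (hα : α ≤ n)
    {F : EuclideanSpace ℝ (Fin n) → ℝ≥0∞} (hF : AEMeasurable F volume)
    (x : EuclideanSpace ℝ (Fin n)) :
    ∫⁻ y, F y / ‖x - y‖ₑ ^ (n - α) ≤
      twoPow (n - α) * ∑' k : ℤ, twoPow (-(k * α)) * nbhdMean k F x := by
  have : Nonempty (Fin n) := ⟨⟨0, hn⟩⟩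
  have hα' : 0 ≤ n - α := by linarith
  have hpt : ∀ᵐ y, F y / ‖x - y‖ₑ ^ (n - α) ≤
      ∑' k : ℤ, (dyadicNbhd k x).indicator (fun y => twoPow ((k + 1) * (n - α)) * F y) y := by
    -- the point `y = x`, where the quotient may be infinite, is a null set
    filter_upwards [compl_mem_ae_iff.2 (measure_singleton x)] with y hy
    have hd : 0 < ‖x - y‖ := norm_sub_pos_iff.2 fun h => hy (by simp [h])
    obtain ⟨l, hl, hl'⟩ := exists_mem_Ico_zpow hd (y := (2 : ℝ)) (by norm_num)
    refine le_trans ?_ (ENNReal.le_tsum (-(l + 1)))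
    have hmem : y ∈ dyadicNbhd (-(l + 1)) x := by
      refine cellAdj_of_dist_le ?_
      rw [dist_eq_norm, neg_neg]
      exact hl'.le
    rw [indicator_of_mem hmem, ENNReal.div_eq_inv_mul]
    gcongr
    rw [← ENNReal.rpow_neg, ENNReal.rpow_neg, ENNReal.inv_le_iff_inv_le]
    have : twoPow l ≤ ‖x - y‖ₑ := by
      rw [twoPow_mul_int_eq_ofReal, ← ofReal_norm]
      exact ENNReal.ofReal_le_ofReal hl
    calc _ = twoPow l ^ (n - α) := by
          rw [twoPow_rpow, twoPow, ← ENNReal.rpow_neg, twoPow]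
          congr 1; push_cast; ring
      _ ≤ _ := by gcongr
  refine (lintegral_mono_ae hpt).trans_eq ?_
  rw [lintegral_tsum fun k =>
    (hF.const_mul _).indicator (measurableSet_dyadicNbhd k x), ← ENNReal.tsum_mul_left]
  refine tsum_congr fun k => ?_
  rw [lintegral_indicator (measurableSet_dyadicNbhd k x), lintegral_const_mul' _ _ (by simp),
    nbhdMean, ← mul_assoc, ← mul_assoc, ← twoPow_add, ← twoPow_add]
  congr 2; ring

theorem hausdorffContent_empty {s : ℝ} (hs : 0 < s) :
    hausdorffContent s (∅ : Set (EuclideanSpace ℝ (Fin n))) = 0 := by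
  refine le_antisymm ?_ bot_le
  refine (hausdorffContent_le_tsum hs (ι := Empty) (fun i => i.elim) (fun i => i.elim)
    (empty_subset _)).trans ?_
  simp

theorem choquetIntegral_hausdorffContent_const_mul {s : ℝ} (hs : 0 < s) {c : ℝ≥0∞} (hc : c ≠ ∞)
    (g : EuclideanSpace ℝ (Fin n) → ℝ≥0∞) :
    choquetIntegral (hausdorffContent s) (fun x => c * g x) =
      c * choquetIntegral (hausdorffContent s) g := by
  rcases eq_or_ne c 0 with rfl | h0
  · simp [choquetIntegral, hausdorffContent_empty hs]
  · exact choquetIntegral_const_mul h0 hc g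

/-- The Hardy–Littlewood–Sobolev inequality for Choquet integrals, for the Riesz potential defined
by a Lebesgue integral. -/
theorem exists_choquetIntegral_riesz_le (hn : 1 ≤ n) {δ α κ p : ℝ} (hδ : δ ∈ Ioc (0 : ℝ) n)
    (hα : α ∈ Ioo 0 δ) (hκ : κ ∈ Ico 0 α) (hp : p ∈ Ioo (δ / n) (δ / α)) :
    ∃ C : ℝ≥0∞, C ≠ ∞ ∧ ∀ F : EuclideanSpace ℝ (Fin n) → ℝ≥0∞, AEMeasurable F volume →
      (choquetIntegral (hausdorffContent (δ - κ * p)) fun x =>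
        (∫⁻ y, F y / ‖x - y‖ₑ ^ (n - α)) ^ (p * (δ - κ * p) / (δ - p * α))) ^
          ((δ - p * α) / (p * (δ - κ * p))) ≤
        C * (choquetIntegral (hausdorffContent δ) fun x => F x ^ p) ^ (1 / p) := by
  obtain ⟨hδ0, hδn⟩ := hδ
  obtain ⟨hα0, hαδ⟩ := hα
  obtain ⟨hκ0, hκα⟩ := hκ
  obtain ⟨hp1, hp2⟩ := hp
  have hn0 : (0 : ℝ) < n := by exact_mod_cast hn
  have hp0 : 0 < p := (div_pos hδ0 hn0).trans hp1
  have hpα : 0 < δ - p * α := by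
    have := (lt_div_iff₀ hα0).1 hp2
    linarith
  have hσ : 0 < δ - κ * p := by nlinarith
  have hbounds : ∃ C : ℝ≥0∞, C ≠ ∞ ∧ ∀ F : EuclideanSpace ℝ (Fin n) → ℝ≥0∞,
      AEMeasurable F volume →
      (∀ k x, nbhdMean k F x ^ p ≤
        C * (twoPow (k * δ) * choquetIntegral (hausdorffContent δ) (fun x => F x ^ p))) ∧
      choquetIntegral (hausdorffContent (δ - κ * p))
        (fun x => ⨆ k : ℤ, twoPow (-(k * (κ * p))) * nbhdMean k F x ^ p) ≤
        C * choquetIntegral (hausdorffContent δ) (fun x => F x ^ p) := by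
    rcases hδn.eq_or_lt with rfl | hlt
    · exact exists_nbhdMean_bounds_of_eq hn hκ0 (by rwa [div_self hn0.ne'] at hp1) hσ
    · exact exists_nbhdMean_bounds_of_lt hδ0 hlt hκ0 hp1 hσ
  obtain ⟨C, hC, hF⟩ := hbounds
  set β := δ / p - α with hβ
  set γ := α - κ with hγ
  have hβ0 : 0 < β := by
    rw [hβ, sub_pos, lt_div_iff₀ hp0]; linarith
  have hγ0 : 0 < γ := by linarith
  have hβγ : 0 < β + γ := add_pos hβ0 hγ0
  obtain ⟨C', hC', hsum⟩ := exists_tsum_min_le hβ0 hγ0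
  set θ := γ / (β + γ) with hθ
  set θ' := β / (β + γ) with hθ'
  have hθ0 : 0 < θ := div_pos hγ0 hβγ
  have hθ'0 : 0 < θ' := div_pos hβ0 hβγ
  set q := p * (δ - κ * p) / (δ - p * α) with hq
  have hq0 : 0 < q := div_pos (mul_pos hp0 hσ) hpα
  have hqinv : (δ - p * α) / (p * (δ - κ * p)) = q⁻¹ := by rw [hq, inv_div]
  have hθq : p⁻¹ * θ' * q = 1 := by
    have e1 : θ' = (δ - p * α) / (δ - κ * p) := by
      rw [hθ', hβ, hγ]
      rw [div_eq_div_iff (by rw [← hβ, ← hγ]; exact hβγ.ne') hσ.ne']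
      field_simp
      ring
    have e2 : ∀ a b : ℝ, a ≠ 0 → b ≠ 0 → p⁻¹ * (a / b) * (p * b / a) = 1 := by
      intro a b ha hb
      field_simp
    rw [e1, hq]
    exact e2 _ _ hpα.ne' hσ.ne'
  have hθθ : θ + θ' = 1 := by rw [hθ, hθ']; field_simp; ring
  have hθq' : p⁻¹ * θ * q + 1 = p⁻¹ * q := by
    rw [← hθq, ← add_mul, ← mul_add, hθθ, mul_one]
  obtain ⟨A, hA⟩ : ∃ A : ℝ≥0∞, A = twoPow (n - α) * C' := ⟨_, rfl⟩
  have hAt : A ≠ ∞ := hA ▸ ENNReal.mul_ne_top (twoPow_ne_top _) hC'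
  refine ⟨A * C ^ p⁻¹ + 1, ?_, fun F hFm => ?_⟩
  · have hCp := ENNReal.rpow_ne_top_of_nonneg (inv_pos.2 hp0).le hC
    exact ENNReal.add_ne_top.2 ⟨ENNReal.mul_ne_top hAt hCp, ENNReal.one_ne_top⟩
  obtain ⟨hmean, hmax⟩ := hF F hFm
  generalize choquetIntegral (hausdorffContent δ) (fun x => F x ^ p) = D at hmean hmax ⊢
  rw [hqinv, one_div]
  rcases eq_or_ne D ∞ with rfl | hD
  · rw [ENNReal.top_rpow_of_pos (inv_pos.2 hp0), ENNReal.mul_top (by simp)]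
    exact le_top
  set M : EuclideanSpace ℝ (Fin n) → ℝ≥0∞ := fun x =>
    ⨆ k : ℤ, twoPow (-(k * (κ * p))) * nbhdMean k F x ^ p with hM
  have hmean1 : ∀ k x, nbhdMean k F x ≤ twoPow (k * (δ / p)) * (C * D) ^ p⁻¹ := fun k x => by
    rw [← ENNReal.rpow_le_rpow_iff hp0, ENNReal.mul_rpow_of_nonneg _ _ hp0.le, twoPow_rpow,
      ENNReal.rpow_inv_rpow hp0.ne', mul_assoc, div_mul_cancel₀ _ hp0.ne', mul_left_comm]
    exact hmean k x
  have hmean2 : ∀ (k : ℤ) x, nbhdMean k F x ≤ twoPow (k * κ) * M x ^ p⁻¹ := fun k x => by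
    rw [← ENNReal.rpow_le_rpow_iff hp0, ENNReal.mul_rpow_of_nonneg _ _ hp0.le, twoPow_rpow,
      ENNReal.rpow_inv_rpow hp0.ne']
    have h := le_iSup (fun k : ℤ => twoPow (-(k * (κ * p))) * nbhdMean k F x ^ p) k
    calc _ = twoPow (k * κ * p) * (twoPow (-(k * (κ * p))) * nbhdMean k F x ^ p) := by
          rw [← mul_assoc, ← twoPow_add]
          rw [show (k : ℝ) * κ * p + -(k * (κ * p)) = 0 by ring, twoPow_zero, one_mul]
      _ ≤ _ := by gcongr
  have hpot : ∀ x, ∫⁻ y, F y / ‖x - y‖ₑ ^ (n - α) ≤ A * (((C * D) ^ p⁻¹) ^ θ * (M x ^ p⁻¹) ^ θ') := by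
    intro x
    refine (lintegral_div_rpow_le hn (hαδ.le.trans hδn) hFm x).trans ?_
    rw [hA, mul_assoc]
    gcongr
    refine le_trans (ENNReal.tsum_le_tsum fun k => ?_) (hsum _ _)
    refine le_min ?_ ?_
    · calc _ ≤ twoPow (-(k * α)) * (twoPow (k * (δ / p)) * (C * D) ^ p⁻¹) := by
            gcongr; exact hmean1 k x
        _ = _ := by
            rw [← mul_assoc, ← twoPow_add]; congr 2; rw [hβ]; ring
    · calc _ ≤ twoPow (-(k * α)) * (twoPow (k * κ) * M x ^ p⁻¹) := by
            gcongr; exact hmean2 k x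
        _ = _ := by
            rw [← mul_assoc, ← twoPow_add]; congr 2; rw [hγ]; ring
  have hpow : ∀ x, (∫⁻ y, F y / ‖x - y‖ₑ ^ (n - α)) ^ q ≤
      (A ^ q * (C * D) ^ (p⁻¹ * θ * q)) * M x := fun x => by
    refine (ENNReal.rpow_le_rpow (hpot x) hq0.le).trans_eq ?_
    rw [ENNReal.mul_rpow_of_nonneg _ _ hq0.le, ENNReal.mul_rpow_of_nonneg _ _ hq0.le,
      ← ENNReal.rpow_mul, ← ENNReal.rpow_mul, ← ENNReal.rpow_mul, ← ENNReal.rpow_mul, ← mul_assoc p⁻¹ θ,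
      ← mul_assoc p⁻¹ θ', hθq, ENNReal.rpow_one, ← mul_assoc (A ^ q)]
  have hexp : 0 < p⁻¹ * θ * q := by positivity
  have hconst : A ^ q * (C * D) ^ (p⁻¹ * θ * q) ≠ ∞ :=
    ENNReal.mul_ne_top (ENNReal.rpow_ne_top_of_nonneg hq0.le hAt)
      (ENNReal.rpow_ne_top_of_nonneg hexp.le (ENNReal.mul_ne_top hC hD))
  calc _ ≤ (A ^ q * (C * D) ^ (p⁻¹ * θ * q) * (C * D)) ^ q⁻¹ := by
        gcongr
        refine (choquetIntegral_mono (hausdorffContent_mono _) hpow).trans ?_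
        rw [choquetIntegral_hausdorffContent_const_mul hσ hconst]
        exact mul_le_mul_right hmax _
    _ = A * C ^ p⁻¹ * D ^ p⁻¹ := by
        have : (C * D) ^ (p⁻¹ * θ * q) * (C * D) = (C * D) ^ (p⁻¹ * q) := by
          rw [← hθq', ENNReal.rpow_add_of_nonneg _ _ hexp.le zero_le_one, ENNReal.rpow_one]
        rw [mul_assoc, this, ENNReal.mul_rpow_of_nonneg _ _ (inv_pos.2 hq0).le,
          ENNReal.rpow_rpow_inv hq0.ne', ENNReal.rpow_mul, ENNReal.rpow_rpow_inv hq0.ne',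
          ENNReal.mul_rpow_of_nonneg _ _ (inv_pos.2 hp0).le, mul_assoc]
    _ ≤ _ := mul_le_mul_left le_self_add _

/-! ### The content Riesz potential and the main inequalities -/

theorem measurable_ereal_abs : Measurable EReal.abs :=
  EReal.measurable_of_measurable_real (by simp only [EReal.abs_def]; fun_prop)

theorem aemeasurable_abs_div_rpow {f : EuclideanSpace ℝ (Fin n) → EReal}
    (hf : NullMeasurable f volume) (x : EuclideanSpace ℝ (Fin n)) (a : ℝ) :
    AEMeasurable (fun y => (f y).abs / ‖x - y‖ₑ ^ a) volume :=
  (measurable_ereal_abs.comp_aemeasurable hf.aemeasurable).div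
    (by fun_prop : Measurable fun y => ‖x - y‖ₑ ^ a).aemeasurable

/-- The content Riesz potential is dominated by the Riesz potential for Lebesgue measure. -/
theorem exists_contentRieszPotential_le (hn : 1 ≤ n) :
    ∃ C : ℝ≥0∞, C ≠ ∞ ∧ ∀ (α : ℝ) (f : EuclideanSpace ℝ (Fin n) → EReal),
      NullMeasurable f volume → ∀ x, contentRieszPotential (n : ℝ) α f x ≤
        C * ∫⁻ y, (f y).abs / ‖x - y‖ₑ ^ (n - α) := by
  obtain ⟨C, hC, hle⟩ := exists_hausdorffContent_le_mul_volume hn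
  refine ⟨C, hC, fun α f hf x => ?_⟩
  rw [← choquetIntegral_measure volume (aemeasurable_abs_div_rpow hf x _)]
  exact choquetIntegral_mono_content hC hle _

theorem exists_nnreal_of_ne_top {C : ℝ≥0∞} (hC : C ≠ ∞) : ∃ c : ℝ≥0, 0 < c ∧ C ≤ c :=
  ⟨C.toNNReal + 1, by positivity, by
    rw [ENNReal.coe_add, ENNReal.coe_toNNReal hC]; exact le_self_add⟩

theorem mainTheorem4 (n : ℕ) (hn : 1 ≤ n) :
    (∀ δ α κ p : ℝ, δ ∈ Ioc (0 : ℝ) n → α ∈ Ioo 0 δ → κ ∈ Ico 0 α → p ∈ Ioo (δ / n) (δ / α) →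
      ∃ c : ℝ≥0, 0 < c ∧
        ∀ f : EuclideanSpace ℝ (Fin n) → EReal, NullMeasurable f volume →
          (choquetIntegral (hausdorffContent (δ - κ * p)) fun x =>
              contentRieszPotential (n : ℝ) α f x ^ (p * (δ - κ * p) / (δ - p * α))) ^
              ((δ - p * α) / (p * (δ - κ * p))) ≤
            c * (choquetIntegral (hausdorffContent δ) fun x => (f x).abs ^ p) ^ (1 / p)) ∧
    (∀ α p : ℝ, α ∈ Ioo (0 : ℝ) n → p ∈ Ioo 1 (n / α) →
      ∃ c : ℝ≥0, 0 < c ∧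
        ∀ f : EuclideanSpace ℝ (Fin n) → EReal, NullMeasurable f volume →
          (∫⁻ x, (∫⁻ y, (f y).abs / ‖x - y‖ₑ ^ (n - α)) ^ (n * p / (n - p * α))) ^
              ((n - p * α) / (n * p)) ≤
            c * (∫⁻ x, (f x).abs ^ p) ^ (1 / p)) := by
  have hn0 : (0 : ℝ) < n := by exact_mod_cast hn
  constructor
  · intro δ α κ p hδ hα hκ hp
    obtain ⟨C₁, hC₁, hriesz⟩ := exists_choquetIntegral_riesz_le hn hδ hα hκ hp
    obtain ⟨C₂, hC₂, hpot⟩ := exists_contentRieszPotential_le hn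
    obtain ⟨c, hc, hCc⟩ := exists_nnreal_of_ne_top (ENNReal.mul_ne_top hC₂ hC₁)
    refine ⟨c, hc, fun f hf => ?_⟩
    have hp0 : 0 < p := (div_pos hδ.1 hn0).trans hp.1
    have hpα : 0 < δ - p * α := by
      have := (lt_div_iff₀ hα.1).1 hp.2
      linarith
    have hσ : 0 < δ - κ * p := by nlinarith [hκ.2]
    have hq0 : 0 < p * (δ - κ * p) / (δ - p * α) := div_pos (mul_pos hp0 hσ) hpα
    have hF := hriesz _ (measurable_ereal_abs.comp_aemeasurable hf.aemeasurable)
    simp only [Function.comp_apply] at hF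
    rw [← inv_div (p * (δ - κ * p))] at hF ⊢
    generalize p * (δ - κ * p) / (δ - p * α) = q at hF hq0 ⊢
    have hpow : ∀ x, contentRieszPotential (n : ℝ) α f x ^ q ≤
        C₂ ^ q * (∫⁻ y, (f y).abs / ‖x - y‖ₑ ^ (n - α)) ^ q := fun x => by
      rw [← ENNReal.mul_rpow_of_nonneg _ _ hq0.le]
      exact ENNReal.rpow_le_rpow (hpot α f hf x) hq0.le
    calc _ ≤ (C₂ ^ q * choquetIntegral (hausdorffContent (δ - κ * p)) fun x =>
          (∫⁻ y, (f y).abs / ‖x - y‖ₑ ^ (n - α)) ^ q) ^ q⁻¹ := by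
          refine ENNReal.rpow_le_rpow ?_ (inv_pos.2 hq0).le
          refine (choquetIntegral_mono (hausdorffContent_mono _) hpow).trans_eq ?_
          exact choquetIntegral_hausdorffContent_const_mul hσ
            (ENNReal.rpow_ne_top_of_nonneg hq0.le hC₂) _
      _ = C₂ * (choquetIntegral (hausdorffContent (δ - κ * p)) fun x =>
          (∫⁻ y, (f y).abs / ‖x - y‖ₑ ^ (n - α)) ^ q) ^ q⁻¹ := by
          rw [ENNReal.mul_rpow_of_nonneg _ _ (inv_pos.2 hq0).le, ENNReal.rpow_rpow_inv hq0.ne']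
      _ ≤ C₂ * (C₁ * _) := mul_le_mul_right hF _
      _ ≤ _ := by
          rw [← mul_assoc]
          exact mul_le_mul_left hCc _
  · intro α p hα hp
    obtain ⟨C₁, hC₁, hriesz⟩ := exists_choquetIntegral_riesz_le hn (δ := n) (α := α) (κ := 0)
      (p := p) ⟨hn0, le_rfl⟩ hα ⟨le_rfl, hα.1⟩ (by rwa [div_self hn0.ne'])
    obtain ⟨C₂, hC₂, hcontent⟩ := exists_hausdorffContent_le_mul_volume hn
    obtain ⟨C₃, hC₃, hvolume⟩ := exists_volume_le_mul_hausdorffContent hn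
    have hp0 : 0 < p := by linarith [hp.1]
    have hpα : 0 < n - p * α := by
      have := (lt_div_iff₀ hα.1).1 hp.2
      linarith
    have hq0 : 0 < n * p / (n - p * α) := div_pos (mul_pos hn0 hp0) hpα
    rw [← inv_div (n * p)]
    simp only [zero_mul, sub_zero] at hriesz
    rw [mul_comm p, ← inv_div (n * p)] at hriesz
    generalize n * p / (n - p * α) = q at hriesz hq0 ⊢
    obtain ⟨c, hc, hCc⟩ := exists_nnreal_of_ne_top
      (C := C₃ ^ q⁻¹ * (C₁ * C₂ ^ (1 / p)))
      (ENNReal.mul_ne_top (ENNReal.rpow_ne_top_of_nonneg (inv_pos.2 hq0).le hC₃)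
        (ENNReal.mul_ne_top hC₁ (ENNReal.rpow_ne_top_of_nonneg (by positivity) hC₂)))
    refine ⟨c, hc, fun f hf => ?_⟩
    have habs : AEMeasurable (fun x => (f x).abs) volume :=
      measurable_ereal_abs.comp_aemeasurable hf.aemeasurable
    calc _ ≤ (C₃ * choquetIntegral (hausdorffContent n) fun x =>
          (∫⁻ y, (f y).abs / ‖x - y‖ₑ ^ (n - α)) ^ q) ^ q⁻¹ := by
          refine ENNReal.rpow_le_rpow ?_ (inv_pos.2 hq0).le
          exact (lintegral_le_choquetIntegral volume _).trans
            (choquetIntegral_mono_content hC₃ hvolume _)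
      _ ≤ C₃ ^ q⁻¹ * (C₁ * (choquetIntegral (hausdorffContent n) fun x =>
          (f x).abs ^ p) ^ (1 / p)) := by
          rw [ENNReal.mul_rpow_of_nonneg _ _ (inv_pos.2 hq0).le]
          exact mul_le_mul_right (hriesz _ habs) _
      _ ≤ C₃ ^ q⁻¹ * (C₁ * (C₂ * ∫⁻ x, (f x).abs ^ p) ^ (1 / p)) := by
          gcongr
          rw [← choquetIntegral_measure volume (habs.pow_const p)]
          exact choquetIntegral_mono_content hC₂ hcontent _
      _ = C₃ ^ q⁻¹ * (C₁ * C₂ ^ (1 / p)) * (∫⁻ x, (f x).abs ^ p) ^ (1 / p) := by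
          rw [ENNReal.mul_rpow_of_nonneg _ _ (by positivity)]; ring
      _ ≤ _ := mul_le_mul_left hCc _
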